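/- Let $k$ be an algebraically closed field of characteristic zero, $\mathbf x=(x_1,\dots,x_m)$, and let $K=k(t,x_1,\dots,x_m)$ with the derivation $\partial_t=\partial/\partial t$. Let $K\langle\partial_t\rangle$ be the ring of linear differential operators in $\partial_t$ with coefficients in $K$, so that $\partial_t a=a\,\partial_t+\partial_t(a)$ for $a\in K$, and let $k(t)\langle\partial_t\rangle\subset K\langle\partial_t\rangle$ be the subring of operators with coefficients in $k(t)$. $Q$ is a right-hand factor of $P$ if $P=MQ$ for some $M\in K\langle\partial_t\rangle$. The least common left multiple ${\rm lclm}$ of a family of operators is the monic operator of minimal order of which all members of the family are right-hand factors, and ${\rm gcrd}(P,Q)$ is the (monic) greatest common right-hand factor. A nonzero $P\in K\langle\partial_t\rangle$ is called * $(\mathbf x,t)$-separable if it is a right-hand factor of some nonzero $L\in k(t)\langle\partial_t\rangle$; * completely reducible if it is the ${\rm lclm}$ of a family of irreducible operators in $K\langle\partial_t\rangle$. For nonzero $P$, an operator $\tilde P$ is similar to $P$ if there is a nonzero $Q\in K\langle\partial_t\rangle$ with ${\rm gcrd}(P,Q)=1$ such that $\tilde P$ is the transformation of $P$ by $Q$,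 i.e. $\tilde P$ is monic and $\tilde P Q=\lambda\,{\rm lclm}(P,Q)$ for some $\lambda\in K$. **Lemma.** Let $P\in K\langle\partial_t\rangle$ be monic, $(\mathbf x,t)$-separable and completely reducible, and let $r\in k[\mathbf x,t]$ be such that all coefficients of $P$ lie in $k(t)[\mathbf x,1/r]$. Let $\mathbf c\in k^m$ be such that the polynomial $r(\mathbf c)=r(\mathbf c,t)\in k[t]$ is not zero, and let $P_{\mathbf x=\mathbf c}\in k(t)\langle\partial_t\rangle$ be the operator obtained by replacing $\mathbf x$ by $\mathbf c$ in the coefficients of $P$. Then $P_{\mathbf x=\mathbf c}$ and $P$ are similar: $P_{\mathbf x=\mathbf c}$ is similar to $P$, and $P$ is similar to $P_{\mathbf x=\mathbf c}$. -/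

import Mathlib

open scoped Polynomial

noncomputable section

/-! ### The ring of linear differential operators over a commutative differential ring -/

section Operators

variable {k A : Type*} [CommRing k] [CommRing A] [Algebra k A]

/-- The ring `A⟨∂⟩` of linear differential operators over the commutative ring `A` with derivation
`δ`. An operator `∑ aᵢ ∂ⁱ` (coefficients on the left) is stored as the polynomial `∑ aᵢ Xⁱ`;
the multiplication is the one determined by `∂ a = a ∂ + δ a`. -/
def DiffOp (_δ : Derivation k A A) : Type _ := A[X]

namespace DiffOp

instance (δ : Derivation k A A) : AddCommGroup (DiffOp δ) := inferInstanceAs (AddCommGroup A[X])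

variable (δ : Derivation k A A)

/-- The operator with given coefficients: `∑ aᵢ Xⁱ ↦ ∑ aᵢ ∂ⁱ`. -/
def ofPoly : A[X] ≃+ DiffOp δ := AddEquiv.refl _

variable {δ}

/-- The polynomial of left coefficients: `∑ aᵢ ∂ⁱ ↦ ∑ aᵢ Xⁱ`. -/
def toPoly : DiffOp δ ≃+ A[X] := (ofPoly δ).symm

/-- The coefficient of `∂ⁱ`. -/
def coeff (P : DiffOp δ) (i : ℕ) : A := (toPoly P).coeff i

/-- The order of an operator (with value `0` for the zero operator). -/
def ord (P : DiffOp δ) : ℕ := (toPoly P).natDegree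

/-- An operator is monic if its leading coefficient is `1`. -/
def Monic (P : DiffOp δ) : Prop := (toPoly P).Monic

variable (δ)

/-- Application of `δ` to all coefficients of a polynomial. -/
def coeffDeriv : A[X] →+ A[X] where
  toFun q := q.sum fun i a => Polynomial.monomial i (δ a)
  map_zero' := by simp
  map_add' p q := Polynomial.sum_add_index p q _ (by simp) (by simp)

/-- Left multiplication by `∂`: `∂ (∑ aᵢ ∂ⁱ) = ∑ aᵢ ∂ⁱ⁺¹ + ∑ δ(aᵢ) ∂ⁱ`. -/
def dMul : A[X] →+ A[X] := AddMonoidHom.mulLeft Polynomial.X + coeffDeriv δ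

/-- The product of operators `(∑ aᵢ ∂ⁱ) q = ∑ aᵢ (∂ⁱ q)`, on polynomials of coefficients. -/
def opMul (p q : A[X]) : A[X] := p.sum fun i a => Polynomial.C a * (dMul δ)^[i] q

instance : Mul (DiffOp δ) := ⟨fun P Q => ofPoly δ (opMul δ (toPoly P) (toPoly Q))⟩

instance : One (DiffOp δ) := ⟨ofPoly δ 1⟩

theorem coeffDeriv_monomial (i : ℕ) (a : A) :
    coeffDeriv δ (Polynomial.monomial i a) = Polynomial.monomial i (δ a) := by
  simp [coeffDeriv, Polynomial.sum_monomial_index]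

theorem coeffDeriv_C_mul (a : A) (q : A[X]) :
    coeffDeriv δ (Polynomial.C a * q)
      = Polynomial.C a * coeffDeriv δ q + Polynomial.C (δ a) * q := by
  induction q using Polynomial.induction_on' with
  | add p q hp hq => simp only [mul_add, map_add, hp, hq]; abel
  | monomial i b =>
    simp only [Polynomial.C_mul_monomial, coeffDeriv_monomial, Derivation.leibniz, smul_eq_mul,
      map_add, mul_comm b]

theorem dMul_C_mul (a : A) (q : A[X]) :
    dMul δ (Polynomial.C a * q) = Polynomial.C a * dMul δ q + Polynomial.C (δ a) * q := by
  simp only [dMul, AddMonoidHom.add_apply, AddMonoidHom.coe_mulLeft, coeffDeriv_C_mul]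
  ring

theorem add_opMul (p q r : A[X]) : opMul δ (p + q) r = opMul δ p r + opMul δ q r :=
  Polynomial.sum_add_index p q _ (by simp) (by simp [add_mul])

theorem opMul_add (p q r : A[X]) : opMul δ p (q + r) = opMul δ p q + opMul δ p r := by
  simp only [opMul, iterate_map_add, mul_add, Polynomial.sum_def, Finset.sum_add_distrib]

theorem opMul_monomial (i : ℕ) (a : A) (q : A[X]) :
    opMul δ (Polynomial.monomial i a) q = Polynomial.C a * (dMul δ)^[i] q :=
  Polynomial.sum_monomial_index _ _ (by simp)

theorem opMul_C_mul (a : A) (q r : A[X]) :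
    opMul δ (Polynomial.C a * q) r = Polynomial.C a * opMul δ q r := by
  induction q using Polynomial.induction_on' with
  | add p q hp hq => simp only [mul_add, add_opMul, hp, hq]
  | monomial i b => simp only [Polynomial.C_mul_monomial, opMul_monomial, map_mul, mul_assoc]

theorem opMul_dMul (q r : A[X]) : opMul δ (dMul δ q) r = dMul δ (opMul δ q r) := by
  induction q using Polynomial.induction_on' with
  | add p q hp hq => simp only [map_add, add_opMul, hp, hq]
  | monomial i b =>
    have h : dMul δ (Polynomial.monomial i b)
        = Polynomial.monomial (i + 1) b + Polynomial.monomial i (δ b) := by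
      simp [dMul, coeffDeriv_monomial, Polynomial.X_mul_monomial]
    simp only [h, add_opMul, opMul_monomial, dMul_C_mul,
      Function.iterate_succ_apply']

theorem opMul_assoc (p q r : A[X]) : opMul δ (opMul δ p q) r = opMul δ p (opMul δ q r) := by
  induction p using Polynomial.induction_on' with
  | add p p' hp hq => simp only [add_opMul, hp, hq]
  | monomial i a =>
    simp only [opMul_monomial, opMul_C_mul]
    congr 1
    induction i with
    | zero => rfl
    | succ i ih => simp only [Function.iterate_succ_apply', opMul_dMul, ih]

theorem one_opMul (q : A[X]) : opMul δ 1 q = q := by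
  rw [← Polynomial.monomial_zero_one, opMul_monomial]; simp

theorem opMul_one (p : A[X]) : opMul δ p 1 = p := by
  induction p using Polynomial.induction_on' with
  | add p p' hp hq => simp only [add_opMul, hp, hq]
  | monomial i a =>
    have h : (dMul δ)^[i] (1 : A[X]) = Polynomial.monomial i 1 := by
      induction i with
      | zero => rfl
      | succ i ih =>
        rw [Function.iterate_succ_apply', ih]
        simp [dMul, coeffDeriv_monomial, Polynomial.X_mul_monomial]
    rw [opMul_monomial, h, Polynomial.C_mul_monomial, mul_one]

instance : Ring (DiffOp δ) where
  __ := (inferInstance : AddCommGroup (DiffOp δ))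
  __ := (inferInstance : Mul (DiffOp δ))
  __ := (inferInstance : One (DiffOp δ))
  left_distrib p q r := opMul_add δ (toPoly p) (toPoly q) (toPoly r)
  right_distrib p q r := add_opMul δ (toPoly p) (toPoly q) (toPoly r)
  zero_mul p := by
    change opMul δ 0 (toPoly p) = 0
    simp [opMul]
  mul_zero p := by
    change opMul δ (toPoly p) 0 = 0
    simp [opMul, iterate_map_zero, Polynomial.sum_def]
  mul_assoc p q r := opMul_assoc δ (toPoly p) (toPoly q) (toPoly r)
  one_mul p := one_opMul δ (toPoly p)
  mul_one p := opMul_one δ (toPoly p)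

/-- An element of `A`, as an operator of order zero. -/
def const (a : A) : DiffOp δ := ofPoly δ (Polynomial.C a)

/-- The operator `∂`. -/
def del : DiffOp δ := ofPoly δ Polynomial.X

theorem del_mul_const (a : A) : del δ * const δ a = const δ a * del δ + const δ (δ a) := by
  change opMul δ Polynomial.X (Polynomial.C a)
    = opMul δ (Polynomial.C a) Polynomial.X + Polynomial.C (δ a)
  simp [opMul, dMul, coeffDeriv, Polynomial.sum_X_index, Polynomial.sum_C_index,
    mul_comm Polynomial.X]

end DiffOp

end Operators

/-! ### Right-hand factors, least common left multiples, similarity -/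

namespace DiffOp

variable {k F : Type*} [CommRing k] [Field F] [Algebra k F] {δ : Derivation k F F}

/-- `Q` is a right-hand factor of `P` (`P` is divisible by `Q` on the right). -/
def IsRightFactor (Q P : DiffOp δ) : Prop := ∃ M : DiffOp δ, P = M * Q

/-- `L` is the least common left multiple of the family `S`: the monic operator of minimal order
that is divisible on the right by all members of `S`. -/
def IsLclm (S : Set (DiffOp δ)) (L : DiffOp δ) : Prop :=
  L.Monic ∧ (∀ Q ∈ S, IsRightFactor Q L) ∧
    ∀ M : DiffOp δ, M.Monic → (∀ Q ∈ S, IsRightFactor Q M) → L.ord ≤ M.ord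

/-- `G` is the greatest common right-hand factor of `P` and `Q` (not both zero): the monic operator
of maximal order that divides both on the right. -/
def IsGcrd (P Q G : DiffOp δ) : Prop :=
  G.Monic ∧ IsRightFactor G P ∧ IsRightFactor G Q ∧
    ∀ R : DiffOp δ, IsRightFactor R P → IsRightFactor R Q → R.ord ≤ G.ord

/-- `P'` is the transformation of `P` by `Q`: it is monic and `P' Q = λ lclm(P, Q)` for some
`λ ∈ F`. (Used for nonzero `P` and `Q`.) -/
def IsTransformation (P Q P' : DiffOp δ) : Prop :=
  P'.Monic ∧ ∃ (M : DiffOp δ) (c : F), IsLclm {P, Q} M ∧ P' * Q = const δ c * M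

/-- `P'` is similar to `P`: there is a nonzero operator `Q` with `gcrd(P, Q) = 1` such that `P'` is
the transformation of `P` by `Q`. -/
def IsSimilarTo (P' P : DiffOp δ) : Prop :=
  ∃ Q : DiffOp δ, Q ≠ 0 ∧ IsGcrd P Q 1 ∧ IsTransformation P Q P'

/-- `P` is completely reducible: it is the least common left multiple of a family of irreducible
operators. -/
def IsCompletelyReducible (P : DiffOp δ) : Prop :=
  ∃ S : Set (DiffOp δ), (∀ Q ∈ S, Irreducible Q) ∧ IsLclm S P

end DiffOp

/-! ### Extension of a derivation to the field of fractions -/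

section Fractions

variable {k A : Type*} [CommRing k] [CommRing A] [IsDomain A] [Algebra k A]

/-- The quotient rule `(a / b)' = (a' b - a b') / b²` is independent of the representation. -/
theorem quotientRule_wd (d : Derivation k A A) {a b a' b' : A} (hb : b ≠ 0) (hb' : b' ≠ 0)
    (h : (algebraMap A (FractionRing A) a) / algebraMap A (FractionRing A) b
      = algebraMap A (FractionRing A) a' / algebraMap A (FractionRing A) b') :
    algebraMap A (FractionRing A) (d a * b - a * d b) / algebraMap A (FractionRing A) b ^ 2
      = algebraMap A (FractionRing A) (d a' * b' - a' * d b')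
        / algebraMap A (FractionRing A) b' ^ 2 := by
  have inj := IsFractionRing.injective A (FractionRing A)
  have e : ∀ {c : A}, c ≠ 0 → algebraMap A (FractionRing A) c ≠ 0 := fun hc h0 =>
    hc (inj (by rw [h0, map_zero]))
  rw [div_eq_div_iff (e hb) (e hb'), ← map_mul, ← map_mul] at h
  have h1 : a * b' = a' * b := inj h
  have h2 := congrArg d h1
  simp only [Derivation.leibniz, smul_eq_mul] at h2
  rw [div_eq_div_iff (pow_ne_zero _ (e hb)) (pow_ne_zero _ (e hb')), ← map_pow, ← map_pow,
    ← map_mul, ← map_mul]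
  congr 1
  linear_combination (b * b') * h2 - (b' * d b + b * d b') * h1

/-- The extension of a derivation of a domain to its field of fractions, as a function:
`(a / b)' = (a' b - a b') / b²`. -/
def fracDerivFun (d : Derivation k A A) (x : FractionRing A) : FractionRing A :=
  let a := (IsLocalization.sec (nonZeroDivisors A) x).1
  let b : A := (IsLocalization.sec (nonZeroDivisors A) x).2
  algebraMap A (FractionRing A) (d a * b - a * d b) / algebraMap A (FractionRing A) b ^ 2

theorem fracDerivFun_div (d : Derivation k A A) (a b : A) (hb : b ≠ 0) :
    fracDerivFun d (algebraMap A (FractionRing A) a / algebraMap A (FractionRing A) b)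
      = algebraMap A (FractionRing A) (d a * b - a * d b)
        / algebraMap A (FractionRing A) b ^ 2 := by
  refine quotientRule_wd d (nonZeroDivisors.ne_zero (IsLocalization.sec _ _).2.2) hb ?_
  rw [← IsFractionRing.mk'_eq_div, IsLocalization.mk'_sec]

/-- The extension of a derivation of a domain to its field of fractions. -/
def fracDeriv (d : Derivation k A A) : Derivation k (FractionRing A) (FractionRing A) :=
  have inj := IsFractionRing.injective A (FractionRing A)
  have e : ∀ {c : A}, c ≠ 0 → algebraMap A (FractionRing A) c ≠ 0 := fun hc h0 =>
    hc (inj (by rw [h0, map_zero]))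
  Derivation.mk'
    { toFun := fracDerivFun d
      map_add' := by
        intro x y
        obtain ⟨a, b, hb, rfl⟩ := IsFractionRing.div_surjective (A := A) x
        obtain ⟨a', b', hb', rfl⟩ := IsFractionRing.div_surjective (A := A) y
        replace hb := nonZeroDivisors.ne_zero hb
        replace hb' := nonZeroDivisors.ne_zero hb'
        have h1 := e hb
        have h2 := e hb'
        rw [div_add_div _ _ h1 h2, ← map_mul, ← map_mul, ← map_mul, ← map_add,
          fracDerivFun_div d _ _ (mul_ne_zero hb hb'), fracDerivFun_div d _ _ hb,
          fracDerivFun_div d _ _ hb']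
        simp only [map_sub, map_mul, map_add, Derivation.leibniz, smul_eq_mul]
        field_simp
        ring
      map_smul' := by
        intro c x
        obtain ⟨a, b, hb, rfl⟩ := IsFractionRing.div_surjective (A := A) x
        replace hb := nonZeroDivisors.ne_zero hb
        have h1 := e hb
        rw [Algebra.smul_def, IsScalarTower.algebraMap_apply k A (FractionRing A), ← mul_div_assoc,
          ← map_mul, fracDerivFun_div d _ _ hb, fracDerivFun_div d _ _ hb, RingHom.id_apply,
          Algebra.smul_def, IsScalarTower.algebraMap_apply k A (FractionRing A)]
        simp only [map_sub, map_mul, Derivation.leibniz, smul_eq_mul, Derivation.map_algebraMap,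
          mul_zero, add_zero]
        field_simp }
    (by
      intro x y
      obtain ⟨a, b, hb, rfl⟩ := IsFractionRing.div_surjective (A := A) x
      obtain ⟨a', b', hb', rfl⟩ := IsFractionRing.div_surjective (A := A) y
      replace hb := nonZeroDivisors.ne_zero hb
      replace hb' := nonZeroDivisors.ne_zero hb'
      have h1 := e hb
      have h2 := e hb'
      change fracDerivFun d _ = _ • fracDerivFun d _ + _ • fracDerivFun d _
      rw [div_mul_div_comm, ← map_mul, ← map_mul,
        fracDerivFun_div d _ _ (mul_ne_zero hb hb'), fracDerivFun_div d _ _ hb,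
        fracDerivFun_div d _ _ hb']
      simp only [map_sub, map_mul, map_add, Derivation.leibniz, smul_eq_mul]
      field_simp
      ring)

end Fractions

/-! ### The field `K = k(t, x₁, …, xₘ)` -/

section RationalFunctions

/-- The polynomial ring `k[t, x₁, …, xₘ]`; the variable `none` is `t`, `some i` is `xᵢ`. -/
abbrev PolyTX (k : Type*) [Field k] (m : ℕ) := MvPolynomial (Option (Fin m)) k

/-- The field `K = k(t, x₁, …, xₘ)`. -/
abbrev RatTX (k : Type*) [Field k] (m : ℕ) := FractionRing (PolyTX k m)

variable {k : Type*} [Field k] {m : ℕ}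

variable (k m) in
/-- The element `t` of `K`. -/
def varT : RatTX k m := algebraMap (PolyTX k m) _ (MvPolynomial.X none)

variable (k) in
/-- The element `xᵢ` of `K`. -/
def varX (i : Fin m) : RatTX k m := algebraMap (PolyTX k m) _ (MvPolynomial.X (some i))

variable (k m) in
/-- The derivation `∂/∂t` of `K`. -/
def derivT : Derivation k (RatTX k m) (RatTX k m) := fracDeriv (MvPolynomial.pderiv none)

variable (k m) in
/-- The subfield `k(t)` of `K`. -/
def fieldT : IntermediateField k (RatTX k m) := IntermediateField.adjoin k {varT k m}

/-- The subring `k(t)[x₁, …, xₘ, 1/r]` of `K`. -/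
def localRing (r : PolyTX k m) : Subalgebra (fieldT k m) (RatTX k m) :=
  Algebra.adjoin (fieldT k m)
    (Set.range (varX k) ∪ {(algebraMap (PolyTX k m) (RatTX k m) r)⁻¹})

/-- The substitution `x = c` in polynomials; the result is a polynomial in `t` only. -/
def substX (c : Fin m → k) : PolyTX k m →ₐ[k] PolyTX k m :=
  MvPolynomial.aeval fun v : Option (Fin m) =>
    v.elim (MvPolynomial.X none) fun i => MvPolynomial.C (c i)

/-- The substitution `x = c` in rational functions: `p / q` in lowest terms goes to
`p(c, t) / q(c, t)`. (It is meaningful where `q(c, t) ≠ 0`, that is, for all `f` that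
can be written with some denominator that does not vanish identically at `x = c`.) -/
def ratSubstX (c : Fin m → k) (f : RatTX k m) : RatTX k m :=
  algebraMap (PolyTX k m) (RatTX k m) (substX c (IsFractionRing.num (PolyTX k m) f)) /
    algebraMap (PolyTX k m) (RatTX k m) (substX c (IsFractionRing.den (PolyTX k m) f))

/-- The operator `P_{x = c}`, obtained by the substitution `x = c` in all coefficients of `P`. -/
def DiffOp.specialize (c : Fin m → k) (P : DiffOp (derivT k m)) : DiffOp (derivT k m) :=
  ofPoly _ ((toPoly P).sum fun i a => Polynomial.monomial i (ratSubstX c a))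

/-- `P` is `(x, t)`-separable: `P` is nonzero and is a right-hand factor of a nonzero operator in
`k(t)⟨∂ₜ⟩`. -/
def DiffOp.IsSeparableXT (P : DiffOp (derivT k m)) : Prop :=
  P ≠ 0 ∧ ∃ L : DiffOp (derivT k m),
    L ≠ 0 ∧ (∀ i, L.coeff i ∈ fieldT k m) ∧ IsRightFactor P L

end RationalFunctions

end

/-! Write D = K⟨∂_t⟩ and let C ⊂ K be the field of ∂_t-constants. Monic operators with isomorphic
cyclic modules D/DP are similar (`isSimilarTo_of_equiv`), so it suffices to construct an isomorphism
D/DP_{x=c} ≅ D/DP.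

The substitution x = c extends to a place of K that commutes with ∂_t and has residue field k(t) ⊂ K
(`exists_isSubstPlace`). As the xⱼ − cⱼ are constants, every nonzero element of K can be scaled by
an element of C to have a nonzero residue. Hence factorizations, annihilation relations and C-linear
independence can be transported to residues.

Complete reducibility makes D/DP semisimple. An operator L over k(t) with P as right-hand factor
kills the generator, hence a nonzero vector in each simple summand T. An operator over k(t) of least
order killing some nonzero vector of T is irreducible even over K, so T ≅ D/DB with B over k(t)
(`exists_cyc_equiv`), and D/DP ≅ ∏ D/DBᵢ. Because k is algebraically closed, the endomorphisms of
D/DB are just the elements of C (`exists_constants_smul`). Consequently a vector generates the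
product exactly when its components in copies of the same module are C-independent.

Let v be the image of the generator of D/DP. Its components in each block are C-independent, and
suitable C-combinations of them have C-independent residues w (`exists_reduces_linearIndependent`);
here K = C(t) with t transcendental over C is used. P kills the combinations, so P_{x=c} kills w,
and w again generates the product. The resulting surjection D/DP_{x=c} → ∏ D/DBᵢ is bijective
because both sides have K-dimension ord P. -/

noncomputable section

namespace DiffOp

/-! ### Arithmetic of operators over a commutative differential ring. -/

section Ring

variable {k A : Type*} [CommRing k] [CommRing A] [Algebra k A] {δ : Derivation k A A}

instance : Module A (DiffOp δ) := inferInstanceAs (Module A A[X])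

@[ext]
theorem ext_coeff {P Q : DiffOp δ} (h : ∀ i, P.coeff i = Q.coeff i) : P = Q :=
  Polynomial.ext (p := toPoly P) (q := toPoly Q) h

@[simp] theorem coeff_zero (i : ℕ) : (0 : DiffOp δ).coeff i = 0 := Polynomial.coeff_zero i

@[simp] theorem coeff_add (P Q : DiffOp δ) (i : ℕ) : (P + Q).coeff i = P.coeff i + Q.coeff i :=
  Polynomial.coeff_add _ _ i

@[simp] theorem coeff_sub (P Q : DiffOp δ) (i : ℕ) : (P - Q).coeff i = P.coeff i - Q.coeff i :=
  Polynomial.coeff_sub _ _ i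

@[simp] theorem coeff_smul (a : A) (P : DiffOp δ) (i : ℕ) : (a • P).coeff i = a * P.coeff i :=
  Polynomial.coeff_smul _ _ i

theorem coeff_sum {ι : Type*} (s : Finset ι) (f : ι → DiffOp δ) (j : ℕ) :
    (∑ i ∈ s, f i).coeff j = ∑ i ∈ s, (f i).coeff j := by
  induction s using Finset.cons_induction with
  | empty => simp
  | cons a s ha ih => rw [Finset.sum_cons, Finset.sum_cons, coeff_add, ih]

theorem coeff_one (i : ℕ) : (1 : DiffOp δ).coeff i = if i = 0 then 1 else 0 := by
  change (1 : A[X]).coeff i = _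
  simp [Polynomial.coeff_one]

@[simp] theorem coeff_ofPoly (p : A[X]) (i : ℕ) : (ofPoly δ p).coeff i = p.coeff i := rfl

theorem coeff_eq_zero_of_ord_lt {P : DiffOp δ} {i : ℕ} (h : P.ord < i) : P.coeff i = 0 :=
  Polynomial.coeff_eq_zero_of_natDegree_lt h

theorem ord_le_iff {P : DiffOp δ} {n : ℕ} : P.ord ≤ n ↔ ∀ i, n < i → P.coeff i = 0 :=
  Polynomial.natDegree_le_iff_coeff_eq_zero

theorem monic_iff {P : DiffOp δ} : P.Monic ↔ P.coeff P.ord = 1 := Iff.rfl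

theorem coeff_ord_ne_zero {P : DiffOp δ} (h : P ≠ 0) : P.coeff P.ord ≠ 0 :=
  (Polynomial.leadingCoeff_ne_zero (p := toPoly P)).mpr h

theorem smul_eq_const_mul (a : A) (P : DiffOp δ) : a • P = const δ a * P := by
  change a • toPoly P = opMul δ (Polynomial.C a) (toPoly P)
  rw [← Polynomial.monomial_zero_left, opMul_monomial, Polynomial.smul_eq_C_mul]
  rfl

instance : IsScalarTower A (DiffOp δ) (DiffOp δ) where
  smul_assoc a P Q := by
    simp only [smul_eq_mul, smul_eq_const_mul, mul_assoc]

theorem coeff_coeffDeriv (q : A[X]) (i : ℕ) : (coeffDeriv δ q).coeff i = δ (q.coeff i) := by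
  induction q using Polynomial.induction_on' with
  | add p q hp hq => simp [hp, hq]
  | monomial j a =>
    rw [coeffDeriv_monomial, Polynomial.coeff_monomial, Polynomial.coeff_monomial]
    split_ifs <;> simp

/-- Applying δ to coefficients does not raise the degree, so each ∂ merely shifts the coefficient at
the degree bound. `m` is only a bound, so that coefficient may vanish. -/
theorem natDegree_iterate_dMul {q : A[X]} {m : ℕ} (hq : q.natDegree ≤ m) (i : ℕ) :
    ((dMul δ)^[i] q).natDegree ≤ i + m ∧ ((dMul δ)^[i] q).coeff (i + m) = q.coeff m := by
  induction i with
  | zero => simpa using hq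
  | succ i ih =>
    rw [Function.iterate_succ_apply']
    generalize (dMul δ)^[i] q = r at ih
    have hz : ∀ j, i + m < j → r.coeff j = 0 := Polynomial.natDegree_le_iff_coeff_eq_zero.mp ih.1
    constructor
    · refine Polynomial.natDegree_le_iff_coeff_eq_zero.mpr fun j hj => ?_
      obtain ⟨j, rfl⟩ : ∃ l, j = l + 1 := ⟨j - 1, by omega⟩
      simp only [dMul, AddMonoidHom.add_apply, AddMonoidHom.coe_mulLeft, Polynomial.coeff_add,
        Polynomial.coeff_X_mul, coeff_coeffDeriv]
      rw [hz j (by omega), hz (j + 1) (by omega)]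
      simp
    · rw [show i + 1 + m = (i + m) + 1 by ring]
      simp only [dMul, AddMonoidHom.add_apply, AddMonoidHom.coe_mulLeft, Polynomial.coeff_add,
        Polynomial.coeff_X_mul, coeff_coeffDeriv]
      rw [hz _ (Nat.lt_succ_self _), ih.2]
      simp

theorem coeff_mul_of_ord_le {P Q : DiffOp δ} {n m : ℕ} (hP : P.ord ≤ n) (hQ : Q.ord ≤ m) :
    (P * Q).ord ≤ n + m ∧ (P * Q).coeff (n + m) = P.coeff n * Q.coeff m := by
  have key : toPoly (P * Q) = ∑ i ∈ Finset.range (n + 1),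
      Polynomial.C (P.coeff i) * (dMul δ)^[i] (toPoly Q) := by
    change opMul δ (toPoly P) (toPoly Q) = _
    rw [opMul, Polynomial.sum_over_range' _ (by simp) (n + 1) (Nat.lt_succ_of_le hP)]
    rfl
  have hd := fun i => natDegree_iterate_dMul (δ := δ) (q := toPoly Q) hQ i
  have hc : ∀ j, (P * Q).coeff j = ∑ i ∈ Finset.range (n + 1),
      P.coeff i * ((dMul δ)^[i] (toPoly Q)).coeff j := by
    intro j
    change (toPoly (P * Q)).coeff j = _
    rw [key, Polynomial.finsetSum_coeff]
    simp
  constructor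
  · rw [ord_le_iff]
    intro j hj
    rw [hc]
    refine Finset.sum_eq_zero fun i hi => ?_
    rw [Finset.mem_range] at hi
    rw [Polynomial.coeff_eq_zero_of_natDegree_lt, mul_zero]
    have := (hd i).1
    omega
  · rw [hc, Finset.sum_range_succ, Finset.sum_eq_zero, zero_add, (hd n).2]
    · rfl
    · intro i hi
      rw [Finset.mem_range] at hi
      rw [Polynomial.coeff_eq_zero_of_natDegree_lt, mul_zero]
      have := (hd i).1
      omega

theorem coeff_del_pow (i j : ℕ) : (del δ ^ i).coeff j = if j = i then 1 else 0 := by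
  have : del δ ^ i = ofPoly δ (Polynomial.X ^ i) := by
    induction i with
    | zero => rfl
    | succ i ih =>
      rw [pow_succ', ih]
      change opMul δ Polynomial.X (Polynomial.X ^ i) = Polynomial.X ^ (i + 1)
      rw [← Polynomial.monomial_one_one_eq_X, opMul_monomial, Polynomial.monomial_one_one_eq_X,
        Polynomial.X_pow_eq_monomial]
      simp [dMul, coeffDeriv_monomial, Polynomial.X_mul_monomial, Polynomial.X_pow_eq_monomial]
  rw [this, coeff_ofPoly, Polynomial.coeff_X_pow]

theorem eq_sum_coeff_smul {P : DiffOp δ} {n : ℕ} (h : P.ord < n) :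
    P = ∑ i ∈ Finset.range n, P.coeff i • del δ ^ i := by
  refine ext_coeff fun j => ?_
  simp only [coeff_sum, coeff_smul, coeff_del_pow]
  by_cases hj : j < n
  · simp [hj]
  · simp only [mul_ite, mul_one, mul_zero, Finset.sum_ite_eq, Finset.mem_range, hj, if_false]
    exact coeff_eq_zero_of_ord_lt (by omega)

/-- Right division by a monic operator. -/
theorem exists_eq_mul_add_of_monic {B : DiffOp δ} (hB : B.Monic) (P : DiffOp δ) :
    ∃ Y R : DiffOp δ, P = Y * B + R ∧ ∀ i, B.ord ≤ i → R.coeff i = 0 := by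
  obtain ⟨n, hn⟩ : ∃ n, ∀ i, n ≤ i → P.coeff i = 0 :=
    ⟨P.ord + 1, fun i hi => coeff_eq_zero_of_ord_lt hi⟩
  induction n generalizing P with
  | zero => exact ⟨0, P, by simp, fun i _ => hn i (Nat.zero_le i)⟩
  | succ n ih =>
    by_cases h : n < B.ord
    · exact ⟨0, P, by simp, fun i hi => hn i (by omega)⟩
    -- As `B` is monic, `Z * B` has the same coefficient at ∂ⁿ as `P`; subtracting it lowers the
    -- bound on the order.
    · set Z : DiffOp δ := P.coeff n • del δ ^ (n - B.ord)
      have hZ : Z.ord ≤ n - B.ord := by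
        rw [ord_le_iff]
        intro i hi
        simp [Z, coeff_del_pow, hi.ne']
      obtain ⟨h1, h2⟩ := coeff_mul_of_ord_le hZ (le_refl B.ord)
      rw [Nat.sub_add_cancel (not_lt.mp h)] at h1 h2
      obtain ⟨Y, R, e, hR⟩ := ih (P - Z * B) (by
        intro i hi
        rcases hi.eq_or_lt with rfl | hi
        · rw [coeff_sub, h2, monic_iff.mp hB]
          simp [Z, coeff_del_pow]
        · rw [coeff_sub, hn i hi, coeff_eq_zero_of_ord_lt (lt_of_le_of_lt h1 hi), sub_zero])
      refine ⟨Y + Z, R, ?_, hR⟩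
      rw [add_mul, add_right_comm, ← e]
      abel

/-- `∂ a = a ∂ + δ a` in modules over the ring of operators. -/
theorem del_smul_smul {T : Type*} [AddCommGroup T] [Module (DiffOp δ) T] [Module A T]
    [IsScalarTower A (DiffOp δ) T] (a : A) (v : T) :
    del δ • a • v = a • del δ • v + δ a • v := by
  have h : ∀ (b : A) (w : T), b • w = const δ b • w := fun b w => by
    rw [← one_smul (DiffOp δ) w, ← smul_assoc, smul_eq_const_mul, smul_smul, mul_one]
  rw [h a v, h a, h (δ a), smul_smul, smul_smul, del_mul_const, add_smul]

/-- A constant commutes with the coefficients and with ∂. This is what makes scaling by constants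
harmless for products and annihilators. -/
theorem const_mul_comm {a : A} (ha : δ a = 0) (P : DiffOp δ) : P * const δ a = const δ a * P := by
  rw [eq_sum_coeff_smul (Nat.lt_succ_self P.ord), Finset.sum_mul, Finset.mul_sum]
  refine Finset.sum_congr rfl fun i hi => ?_
  clear hi
  have h1 : del δ ^ i * const δ a = const δ a * del δ ^ i := by
    induction i with
    | zero => simp
    | succ i ih =>
      have h0 : const δ (0 : A) = 0 := by ext; simp [const]
      rw [pow_succ, mul_assoc, del_mul_const, ha, h0, add_zero, ← mul_assoc, ih, mul_assoc]
  rw [smul_eq_const_mul, mul_assoc, h1, ← mul_assoc, ← mul_assoc]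
  congr 1
  rw [← smul_eq_const_mul, ← smul_eq_const_mul]
  ext j
  simp only [coeff_smul, const, coeff_ofPoly, Polynomial.coeff_C]
  split_ifs <;> ring

section Map

variable {k' A' : Type*} [CommRing k'] [CommRing A'] [Algebra k' A'] {δ' : Derivation k' A' A'}

/-- The homomorphism of rings of operators induced by a homomorphism of differential rings. -/
def map (f : A →+* A') (hf : ∀ a, f (δ a) = δ' (f a)) : DiffOp δ →+* DiffOp δ' where
  toFun P := ofPoly δ' ((toPoly P).map f)
  map_one' := Polynomial.map_one f
  map_zero' := Polynomial.map_zero f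
  map_add' P Q := Polynomial.map_add f (p := toPoly P) (q := toPoly Q)
  map_mul' P Q := by
    change (opMul δ (toPoly P) (toPoly Q)).map f
      = opMul δ' ((toPoly P).map f) ((toPoly Q).map f)
    have h1 : ∀ q : A[X], (dMul δ q).map f = dMul δ' (q.map f) := by
      intro q
      ext i
      simp only [dMul, AddMonoidHom.add_apply, AddMonoidHom.coe_mulLeft, Polynomial.coeff_map,
        Polynomial.coeff_add, coeff_coeffDeriv, map_add, hf]
      congr 1
      rw [← Polynomial.coeff_map, Polynomial.map_mul, Polynomial.map_X]
    generalize toPoly P = p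
    induction p using Polynomial.induction_on' with
    | add p p' hp hq => simp only [Polynomial.map_add, add_opMul, hp, hq]
    | monomial i a =>
      rw [opMul_monomial, Polynomial.map_monomial, opMul_monomial, Polynomial.map_mul,
        Polynomial.map_C]
      congr 1
      induction i with
      | zero => rfl
      | succ i ih => rw [Function.iterate_succ_apply', Function.iterate_succ_apply', h1, ih]

@[simp] theorem coeff_map (f : A →+* A') (hf : ∀ a, f (δ a) = δ' (f a)) (P : DiffOp δ) (i : ℕ) :
    (map f hf P).coeff i = f (P.coeff i) := Polynomial.coeff_map f i

end Map

end Ring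

/-! ### Right division, left ideals and cyclic modules over a differential field. -/

section Field

variable {k F : Type*} [CommRing k] [Field F] [Algebra k F] {δ : Derivation k F F}

instance : Nontrivial (DiffOp δ) := inferInstanceAs (Nontrivial F[X])

theorem coeff_mul_ord (P Q : DiffOp δ) :
    (P * Q).coeff (P.ord + Q.ord) = P.coeff P.ord * Q.coeff Q.ord :=
  (coeff_mul_of_ord_le le_rfl le_rfl).2

instance : NoZeroDivisors (DiffOp δ) where
  eq_zero_or_eq_zero_of_mul_eq_zero {P Q} h := by
    by_contra! hc
    have := coeff_mul_ord P Q
    rw [h, coeff_zero] at this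
    exact mul_ne_zero (coeff_ord_ne_zero hc.1) (coeff_ord_ne_zero hc.2) this.symm

theorem ord_mul {P Q : DiffOp δ} (hP : P ≠ 0) (hQ : Q ≠ 0) : (P * Q).ord = P.ord + Q.ord := by
  refine le_antisymm (coeff_mul_of_ord_le le_rfl le_rfl).1 ?_
  by_contra! h
  have := coeff_mul_ord P Q
  rw [coeff_eq_zero_of_ord_lt h] at this
  exact mul_ne_zero (coeff_ord_ne_zero hP) (coeff_ord_ne_zero hQ) this.symm

theorem Monic.ne_zero {P : DiffOp δ} (h : P.Monic) : P ≠ 0 := Polynomial.Monic.ne_zero h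

theorem monic_one : (1 : DiffOp δ).Monic := Polynomial.monic_one

theorem ord_one : (1 : DiffOp δ).ord = 0 := Polynomial.natDegree_one

theorem ord_smul {a : F} (ha : a ≠ 0) (P : DiffOp δ) : (a • P).ord = P.ord :=
  Polynomial.natDegree_smul (toPoly P) ha

theorem monic_smul {P : DiffOp δ} (hP : P ≠ 0) : ((P.coeff P.ord)⁻¹ • P).Monic := by
  have h := coeff_ord_ne_zero hP
  rw [monic_iff, ord_smul (inv_ne_zero h), coeff_smul, inv_mul_cancel₀ h]

theorem isUnit_of_ord_eq_zero {P : DiffOp δ} (hP : P ≠ 0) (h : P.ord = 0) : IsUnit P := by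
  have h0 := coeff_ord_ne_zero hP
  rw [h] at h0
  have e : ∀ a : F, const δ a = a • 1 := fun a => by rw [smul_eq_const_mul, mul_one]
  have hPe : P = P.coeff 0 • 1 := by
    conv_lhs => rw [eq_sum_coeff_smul (show P.ord < 1 by omega)]
    simp
  refine ⟨⟨P, (P.coeff 0)⁻¹ • 1, ?_, ?_⟩, rfl⟩
  · nth_rewrite 1 [hPe]
    rw [smul_mul_assoc, one_mul, smul_smul, mul_inv_cancel₀ h0, one_smul]
  · rw [smul_mul_assoc, one_mul]
    nth_rewrite 2 [hPe]
    rw [smul_smul, inv_mul_cancel₀ h0, one_smul]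

theorem ord_eq_zero_of_mul_eq_one {P Q : DiffOp δ} (h : P * Q = 1) : P.ord = 0 ∧ Q.ord = 0 := by
  have h1 : P ≠ 0 := by rintro rfl; simp at h
  have h2 : Q ≠ 0 := by rintro rfl; simp at h
  have := ord_mul h1 h2
  rw [h, ord_one] at this
  omega

theorem ord_lt_of_coeff {R B : DiffOp δ} (hR0 : R ≠ 0) (hR : ∀ i, B.ord ≤ i → R.coeff i = 0) :
    R.ord < B.ord := by
  by_contra! h
  exact coeff_ord_ne_zero hR0 (hR _ h)

/-- A multiple of an operator of higher order vanishes. -/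
theorem eq_zero_of_mem_span {R B : DiffOp δ} (hR : ∀ i, B.ord ≤ i → R.coeff i = 0)
    (h : R ∈ Ideal.span {B}) : R = 0 := by
  by_contra h0
  obtain ⟨Y, rfl⟩ := Ideal.mem_span_singleton'.mp h
  have hY : Y ≠ 0 := by rintro rfl; simp at h0
  have hB : B ≠ 0 := by rintro rfl; simp at h0
  have := ord_lt_of_coeff h0 hR
  rw [ord_mul hY hB] at this
  omega

/-- Right division by a nonzero element of least order leaves no remainder, so left ideals are
principal. -/
theorem exists_monic_generator {I : Ideal (DiffOp δ)} (hI : I ≠ ⊥) :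
    ∃ G : DiffOp δ, G.Monic ∧ I = Ideal.span {G} := by
  classical
  have hex : ∃ n, ∃ G ∈ I, G ≠ 0 ∧ G.ord = n := by
    obtain ⟨G, h1, h2⟩ := Submodule.exists_mem_ne_zero_of_ne_bot hI
    exact ⟨_, G, h1, h2, rfl⟩
  obtain ⟨G, hG, hG0, hn⟩ := Nat.find_spec hex
  have hm := monic_smul hG0
  have hmem : (G.coeff G.ord)⁻¹ • G ∈ I := by
    rw [smul_eq_const_mul]; exact I.mul_mem_left _ hG
  refine ⟨_, hm, le_antisymm (fun X hX => ?_) ?_⟩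
  · obtain ⟨Y, R, rfl, hR⟩ := exists_eq_mul_add_of_monic hm X
    have hRI : R ∈ I := (Submodule.add_mem_iff_right I (I.mul_mem_left Y hmem)).mp hX
    by_cases hR0 : R = 0
    · rw [hR0, add_zero]
      exact Ideal.mul_mem_left _ _ (Ideal.mem_span_singleton_self _)
    · have h1 := ord_lt_of_coeff hR0 hR
      rw [ord_smul (inv_ne_zero (coeff_ord_ne_zero hG0)), hn] at h1
      exact absurd ⟨R, hRI, hR0, rfl⟩ (Nat.find_min hex h1)
  · rwa [Ideal.span_singleton_le_iff_mem]

theorem isRightFactor_iff {P Q : DiffOp δ} : IsRightFactor Q P ↔ P ∈ Ideal.span {Q} := by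
  rw [Ideal.mem_span_singleton']
  exact ⟨fun ⟨M, h⟩ => ⟨M, h.symm⟩, fun ⟨M, h⟩ => ⟨M, h.symm⟩⟩

/-- The cyclic module attached to an operator. -/
abbrev Cyc (P : DiffOp δ) : Type _ := DiffOp δ ⧸ Ideal.span {P}

/-- The class of an operator in the cyclic module. -/
abbrev mk (P X : DiffOp δ) : Cyc P := Submodule.Quotient.mk X

theorem mk_eq_zero {P X : DiffOp δ} : mk P X = 0 ↔ X ∈ Ideal.span {P} :=
  Submodule.Quotient.mk_eq_zero _

/-- A left ideal containing Q has the form D G with Q = M G. Irreducibility makes M or G a unit, so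
the ideal is D Q or D. -/
theorem isSimpleModule_cyc {Q : DiffOp δ} (hQ : Irreducible Q) :
    IsSimpleModule (DiffOp δ) (Cyc Q) := by
  rw [isSimpleModule_iff_isCoatom]
  refine ⟨fun h => hQ.not_isUnit ?_, fun I hI => ?_⟩
  · obtain ⟨M, hM⟩ := Ideal.mem_span_singleton'.mp ((Ideal.eq_top_iff_one _).mp h)
    exact isUnit_of_ord_eq_zero hQ.ne_zero (ord_eq_zero_of_mul_eq_one hM).2
  · have hIbot : I ≠ ⊥ := by rintro rfl; exact not_lt_bot hI
    obtain ⟨G, -, rfl⟩ := exists_monic_generator hIbot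
    obtain ⟨M, hM⟩ := Ideal.mem_span_singleton'.mp
      (hI.le (Ideal.mem_span_singleton_self Q))
    rcases hQ.isUnit_or_isUnit hM.symm with h | h
    · refine absurd ?_ hI.not_ge
      rw [Ideal.span_singleton_le_iff_mem, Ideal.mem_span_singleton']
      obtain ⟨u, rfl⟩ := h
      exact ⟨↑u⁻¹, by rw [← hM, ← mul_assoc, Units.inv_mul, one_mul]⟩
    · rw [Ideal.eq_top_iff_one, Ideal.mem_span_singleton']
      obtain ⟨u, rfl⟩ := h
      exact ⟨↑u⁻¹, Units.inv_mul u⟩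

/-- The operators of order less than `ord P` represent the classes modulo `P`. -/
theorem exists_mk_eq {P : DiffOp δ} (hP : P.Monic) (v : Cyc P) :
    ∃ X : DiffOp δ, mk P X = v ∧ ∀ i, P.ord ≤ i → X.coeff i = 0 := by
  obtain ⟨Z, rfl⟩ := Submodule.Quotient.mk_surjective _ v
  obtain ⟨Y, R, rfl, hR⟩ := exists_eq_mul_add_of_monic hP Z
  refine ⟨R, ?_, hR⟩
  rw [Submodule.Quotient.eq]
  rw [show R - (Y * P + R) = (-Y) * P by noncomm_ring]
  exact Ideal.mul_mem_left _ _ (Ideal.mem_span_singleton_self _)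

/-- The coordinates of the cyclic module. -/
def coordEquiv {P : DiffOp δ} (hP : P.Monic) : Polynomial.degreeLT F P.ord ≃ₗ[F] Cyc P :=
  LinearEquiv.ofBijective
    (((Submodule.mkQ (Ideal.span {P})).restrictScalars F).comp
      (Polynomial.degreeLT F P.ord).subtype) <| by
    constructor
    · rw [← LinearMap.ker_eq_bot, LinearMap.ker_eq_bot']
      rintro ⟨x, hx⟩ h
      have hx' : ∀ i, P.ord ≤ i → (ofPoly δ x).coeff i = 0 := fun i hi =>
        Polynomial.coeff_eq_zero_of_degree_lt
          (lt_of_lt_of_le (Polynomial.mem_degreeLT.mp hx) (by exact_mod_cast hi))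
      exact Subtype.ext (eq_zero_of_mem_span (R := ofPoly δ x) hx'
        ((Submodule.Quotient.mk_eq_zero _).mp h))
    · intro v
      obtain ⟨X, rfl, hX⟩ := exists_mk_eq hP v
      refine ⟨⟨toPoly X, ?_⟩, rfl⟩
      rw [Polynomial.mem_degreeLT, Polynomial.degree_lt_iff_coeff_zero]
      exact hX

theorem finite_cyc {P : DiffOp δ} (hP : P.Monic) : Module.Finite F (Cyc P) :=
  Module.Finite.equiv ((Polynomial.degreeLTEquiv F P.ord).symm.trans (coordEquiv hP))

/-- Turns equality of orders into the dimension count by which a surjection of modules becomes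
bijective. -/
theorem finrank_cyc {P : DiffOp δ} (hP : P.Monic) : Module.finrank F (Cyc P) = P.ord := by
  rw [← ((Polynomial.degreeLTEquiv F P.ord).symm.trans (coordEquiv hP)).finrank_eq]
  simp

end Field

end DiffOp

/-! ### Constants of a differential field. -/

section Constants

variable {k K : Type*} [Field k] [Field K] [Algebra k K]

/-- The field of constants of a differential field. -/
def constants (δ : Derivation k K K) : Subfield K where
  carrier := {a | δ a = 0}
  mul_mem' {a b} ha hb := by
    simp only [Set.mem_ofPred_eq] at *
    simp [ha, hb]
  one_mem' := by simp
  add_mem' {a b} ha hb := by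
    simp only [Set.mem_ofPred_eq] at *
    simp [ha, hb]
  zero_mem' := by simp
  neg_mem' {a} ha := by
    simp only [Set.mem_ofPred_eq] at *
    simp [ha]
  inv_mem' a ha := by
    simp only [Set.mem_ofPred_eq] at *
    simp [Derivation.leibniz_inv, ha]

variable {δ : Derivation k K K}

theorem deriv_aeval_constants {t : K} (ht : δ t = 1) (p : (constants δ)[X]) :
    δ (Polynomial.aeval t p) = Polynomial.aeval t p.derivative := by
  induction p using Polynomial.induction_on' with
  | add p q hp hq => simp [hp, hq]
  | monomial i a =>
    have ha : δ (algebraMap (constants δ) K a) = 0 := a.2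
    rw [Polynomial.aeval_monomial, Polynomial.derivative_monomial, Polynomial.aeval_monomial,
      Derivation.leibniz, Derivation.leibniz_pow, ht]
    simp only [ha, smul_eq_mul, mul_one,
      nsmul_eq_mul, map_mul, map_natCast]
    ring

/-- In characteristic zero, an element with derivative `1` is transcendental over the constants. -/
theorem eq_zero_of_aeval_eq_zero [CharZero K] {t : K} (ht : δ t = 1) {p : (constants δ)[X]}
    (hp : Polynomial.aeval t p = 0) : p = 0 := by
  induction hn : p.natDegree using Nat.strong_induction_on generalizing p with
  | _ n ih =>
    -- Differentiating the relation gives one for `p.derivative`, which is zero by induction on the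
    -- degree; in characteristic zero `p` is then constant.
    have hconst : p.natDegree = 0 := by
      by_contra h0
      have h1 : p.derivative = 0 := by
        refine ih _ (hn ▸ Polynomial.natDegree_derivative_lt h0) ?_ rfl
        rw [← deriv_aeval_constants ht, hp, map_zero]
      exact h0 (Polynomial.derivative_eq_zero.mp h1)
    rw [Polynomial.eq_C_of_natDegree_eq_zero hconst] at hp ⊢
    rw [Polynomial.aeval_C] at hp
    rw [(map_eq_zero _).mp hp, map_zero]

/-- `hK` expresses K = C(t). The product of the individual denominators serves all the given
elements. -/
theorem exists_common_denominator {t : K}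
    (hK : ∀ a : K, ∃ p q : (constants δ)[X], Polynomial.aeval t q ≠ 0 ∧
      a * Polynomial.aeval t q = Polynomial.aeval t p)
    {ι : Type*} [Finite ι] (a : ι → K) :
    ∃ (p : ι → (constants δ)[X]) (q : (constants δ)[X]), Polynomial.aeval t q ≠ 0 ∧
      ∀ i, a i * Polynomial.aeval t q = Polynomial.aeval t (p i) := by
  classical
  have := Fintype.ofFinite ι
  choose p q hq h using fun i => hK (a i)
  refine ⟨fun i => p i * ∏ j ∈ Finset.univ.erase i, q j, ∏ j, q j, ?_, fun i => ?_⟩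
  · rw [map_prod]
    exact Finset.prod_ne_zero_iff.mpr fun i _ => hq i
  · rw [← Finset.mul_prod_erase _ _ (Finset.mem_univ i), map_mul, ← mul_assoc, h, map_mul]

end Constants

namespace DiffOp

/-! ### Module endomorphisms and their minimal polynomials. -/

section Commutator

variable {k K : Type*} [Field k] [Field K] [Algebra k K] {δ : Derivation k K K}
variable {T : Type*} [AddCommGroup T] [Module (DiffOp δ) T] [Module K T]
  [IsScalarTower K (DiffOp δ) T]

/-- Multiplication by a constant commutes with all operators. -/
theorem smul_const_smul {c : K} (hc : δ c = 0) (P : DiffOp δ) (v : T) : P • c • v = c • P • v := by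
  have h : ∀ w : T, c • w = const δ c • w := fun w => by
    rw [← one_smul (DiffOp δ) w, ← smul_assoc, smul_eq_const_mul, smul_smul, mul_one]
  rw [h, h, smul_smul, smul_smul, const_mul_comm hc]

variable (T) in
/-- Multiplication by a constant, as an endomorphism. -/
def constEnd (c : constants δ) : T →ₗ[DiffOp δ] T where
  toFun v := (c : K) • v
  map_add' := smul_add _
  map_smul' P v := (smul_const_smul c.2 P v).symm

@[simp] theorem constEnd_apply (c : constants δ) (v : T) : constEnd T c v = (c : K) • v := rfl

theorem restrictScalars_pow_apply (θ : T →ₗ[DiffOp δ] T) (i : ℕ) (v : T) :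
    ((θ.restrictScalars K) ^ i) v = (θ ^ i) v := by
  induction i with
  | zero => rfl
  | succ i ih => rw [pow_succ', pow_succ', Module.End.mul_apply, Module.End.mul_apply, ih]; rfl

/-- Since θ commutes with ∂, only the coefficients of p contribute to the commutator: [∂, p(θ)] =
(δp)(θ). -/
theorem del_smul_aeval (θ : T →ₗ[DiffOp δ] T) (p : K[X]) (v : T) :
    del δ • (Polynomial.aeval (θ.restrictScalars K) p) v
      = (Polynomial.aeval (θ.restrictScalars K) p) (del δ • v)
        + (Polynomial.aeval (θ.restrictScalars K) (coeffDeriv δ p)) v := by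
  induction p using Polynomial.induction_on' with
  | add p q hp hq =>
    simp only [map_add, LinearMap.add_apply, smul_add, hp, hq]
    abel
  | monomial i a =>
    rw [coeffDeriv_monomial]
    simp only [Polynomial.aeval_monomial, Module.End.mul_apply, Module.algebraMap_end_apply,
      restrictScalars_pow_apply, del_smul_smul, map_smul]

/-- The minimal polynomial of an endomorphism has constant coefficients. -/
theorem deriv_coeff_minpoly [Module.Finite K T] (θ : T →ₗ[DiffOp δ] T) (i : ℕ) :
    δ ((minpoly K (θ.restrictScalars K)).coeff i) = 0 := by
  set p := minpoly K (θ.restrictScalars K)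
  have hint : IsIntegral K (θ.restrictScalars K) := Algebra.IsIntegral.isIntegral _
  have hm : p.Monic := minpoly.monic hint
  -- From p(θ) = 0 the commutator formula gives (δp)(θ) = 0. As p is monic, δp has smaller degree,
  -- so it vanishes by minimality.
  have h0 : Polynomial.aeval (θ.restrictScalars K) (coeffDeriv δ p) = 0 := by
    refine LinearMap.ext fun v => ?_
    have := del_smul_aeval θ p v
    rw [minpoly.aeval] at this
    simpa using this.symm
  rw [← coeff_coeffDeriv]
  by_contra hne
  have hne' : coeffDeriv δ p ≠ 0 := fun h => hne (by rw [h, Polynomial.coeff_zero])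
  have hle := minpoly.degree_le_of_ne_zero K _ hne' h0
  refine hle.not_gt ((Polynomial.degree_lt_iff_coeff_zero _ _).mpr ?_ |>.trans_eq
    (Polynomial.degree_eq_natDegree hm.ne_zero).symm)
  intro j hj
  rw [coeff_coeffDeriv]
  rcases hj.eq_or_lt with h | h
  · rw [← h, hm.coeff_natDegree, Derivation.map_one_eq_zero]
  · rw [Polynomial.coeff_eq_zero_of_natDegree_lt h, map_zero]

end Commutator

end DiffOp

/-! ### Differential places and the reduction of operators. -/

/-- A place of a differential field `K` with values in a subfield of `K`, given by its graph:
`(a, b) ∈ G` means that `a` lies in the valuation ring and has the residue `b`. The residue field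
consists of elements that are their own residues, and constants have residues in `k`. -/
structure DiffPlace {k K : Type*} [Field k] [Field K] [Algebra k K] (δ : Derivation k K K) where
  /-- The graph. -/
  graph : Subring (K × K)
  eq_zero : ∀ {b}, (0, b) ∈ graph → b = 0
  mem_or : ∀ {a : K}, a ≠ 0 → (∃ b, (a, b) ∈ graph) ∨ ∃ b, (a⁻¹, b) ∈ graph
  inv_mem : ∀ {a b}, (a, b) ∈ graph → b ≠ 0 → (a⁻¹, b⁻¹) ∈ graph
  deriv_mem : ∀ {a b}, (a, b) ∈ graph → (δ a, δ b) ∈ graph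
  idem : ∀ {a b}, (a, b) ∈ graph → (b, b) ∈ graph
  -- Every value is attained by a constant, so denominators can be cleared without disturbing ∂.
  scale : ∀ {a : K}, a ≠ 0 → ∃ c, c ≠ 0 ∧ δ c = 0 ∧ ∃ b, b ≠ 0 ∧ (c * a, b) ∈ graph
  const_mem : ∀ {a b}, (a, b) ∈ graph → δ a = 0 → ∃ x : k, b = algebraMap k K x

namespace DiffPlace

open DiffOp

variable {k K : Type*} [Field k] [Field K] [Algebra k K] {δ : Derivation k K K} (pl : DiffPlace δ)

theorem mul_mem {a b a' b' : K} (h : (a, b) ∈ pl.graph) (h' : (a', b') ∈ pl.graph) :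
    (a * a', b * b') ∈ pl.graph := pl.graph.mul_mem h h'

theorem zero_mem : ((0 : K), (0 : K)) ∈ pl.graph := pl.graph.zero_mem

theorem one_mem : ((1 : K), (1 : K)) ∈ pl.graph := pl.graph.one_mem

theorem pow_mem {a b : K} (h : (a, b) ∈ pl.graph) (n : ℕ) : (a ^ n, b ^ n) ∈ pl.graph :=
  pl.graph.pow_mem h n

theorem unique {a b b' : K} (h : (a, b) ∈ pl.graph) (h' : (a, b') ∈ pl.graph) : b = b' := by
  have := pl.graph.sub_mem h h'
  rw [Prod.mk_sub_mk, sub_self] at this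
  exact sub_eq_zero.mp (pl.eq_zero this)

/-- The entry found has the least value: dividing by it makes the whole family integral. Values are
compared through `mem_or`, without a value group. -/
theorem exists_dominant {ι : Type*} (a : ι → K) (s : Finset ι) :
    (∀ i ∈ s, a i = 0) ∨ ∃ i ∈ s, a i ≠ 0 ∧ ∀ j ∈ s, ∃ b, (a j / a i, b) ∈ pl.graph := by
  classical
  induction s using Finset.induction_on with
  | empty => simp
  | insert n s _ ih =>
    by_cases hn : a n = 0
    · rcases ih with ih | ⟨i, hi, h0, h⟩
      · left
        simpa [hn] using ih
      · refine .inr ⟨i, Finset.mem_insert_of_mem hi, h0, fun j hj => ?_⟩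
        rcases Finset.mem_insert.mp hj with rfl | hj
        · exact ⟨0, by simpa [hn] using pl.zero_mem⟩
        · exact h j hj
    · right
      have hnn : ∃ b, (a n / a n, b) ∈ pl.graph := ⟨1, by rw [div_self hn]; exact pl.one_mem⟩
      rcases ih with ih | ⟨i, hi, h0, h⟩
      · refine ⟨n, Finset.mem_insert_self _ _, hn, fun j hj => ?_⟩
        rcases Finset.mem_insert.mp hj with rfl | hj
        · exact hnn
        · exact ⟨0, by simpa [ih j hj] using pl.zero_mem⟩
      · rcases pl.mem_or (div_ne_zero hn h0) with hb | ⟨b, hb⟩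
        · refine ⟨i, Finset.mem_insert_of_mem hi, h0, fun j hj => ?_⟩
          rcases Finset.mem_insert.mp hj with rfl | hj
          · exact hb
          · exact h j hj
        · refine ⟨n, Finset.mem_insert_self _ _, hn, fun j hj => ?_⟩
          rcases Finset.mem_insert.mp hj with rfl | hj
          · exact hnn
          · obtain ⟨b', hb'⟩ := h j hj
            refine ⟨b' * b, ?_⟩
            have := pl.mul_mem hb' hb
            rwa [inv_div, div_mul_div_cancel₀ h0] at this

/-- A nonzero vector can be scaled by a constant to have a nonzero reduction. -/
theorem exists_primitive {ι : Type*} [Finite ι] {a : ι → K} (ha : a ≠ 0) :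
    ∃ c, c ≠ 0 ∧ δ c = 0 ∧ ∃ b : ι → K, b ≠ 0 ∧ ∀ i, (c * a i, b i) ∈ pl.graph := by
  have := Fintype.ofFinite ι
  rcases pl.exists_dominant a Finset.univ with h | ⟨i, -, h0, h⟩
  · exact absurd (funext fun i => h i (Finset.mem_univ i)) ha
  · obtain ⟨c, hc0, hc, β, hβ, hcβ⟩ := pl.scale h0
    choose b hb using fun j => h j (Finset.mem_univ j)
    have key : ∀ j, (c * a j, β * b j) ∈ pl.graph := fun j => by
      have := pl.mul_mem hcβ (hb j)
      rwa [mul_assoc, mul_div_cancel₀ _ h0] at this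
    refine ⟨c, hc0, hc, fun j => β * b j, fun h' => ?_, key⟩
    have h1 := key i
    rw [congrFun h' i] at h1
    exact hβ (pl.unique hcβ h1)

theorem deriv_eq_zero {a b : K} (h : (a, b) ∈ pl.graph) (ha : δ a = 0) : δ b = 0 := by
  obtain ⟨x, rfl⟩ := pl.const_mem h ha
  exact δ.map_algebraMap x

/-- The derivation of the graph. -/
def deriv : Derivation ℤ pl.graph pl.graph :=
  Derivation.mk'
    (AddMonoidHom.toIntLinearMap
      { toFun := fun x => ⟨(δ x.1.1, δ x.1.2), pl.deriv_mem x.2⟩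
        map_zero' := by ext <;> simp
        map_add' := fun x y => by ext <;> simp })
    (fun x y => by ext <;> simp)

/-- The operators with coefficients in the valuation ring. -/
def gen : DiffOp pl.deriv →+* DiffOp δ :=
  DiffOp.map ((RingHom.fst K K).comp pl.graph.subtype) fun _ => rfl

/-- The reduction of operators with coefficients in the valuation ring. -/
def red : DiffOp pl.deriv →+* DiffOp δ :=
  DiffOp.map ((RingHom.snd K K).comp pl.graph.subtype) fun _ => rfl

theorem coeff_gen (X : DiffOp pl.deriv) (i : ℕ) : (pl.gen X).coeff i = (X.coeff i).1.1 :=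
  DiffOp.coeff_map _ _ _ _

theorem coeff_red (X : DiffOp pl.deriv) (i : ℕ) : (pl.red X).coeff i = (X.coeff i).1.2 :=
  DiffOp.coeff_map _ _ _ _

theorem coeff_mem (X : DiffOp pl.deriv) (i : ℕ) :
    ((pl.gen X).coeff i, (pl.red X).coeff i) ∈ pl.graph := by
  rw [coeff_gen, coeff_red]
  exact (X.coeff i).2

/-- An element determines its residue, so the graph is a copy of the valuation ring, and operators
over the graph carry no more data than their images under `gen`. -/
theorem fst_injective : Function.Injective ((RingHom.fst K K).comp pl.graph.subtype) := by
  rw [injective_iff_map_eq_zero]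
  rintro ⟨⟨a, b⟩, h⟩ (rfl : a = 0)
  obtain rfl := pl.eq_zero h
  rfl

theorem gen_injective : Function.Injective pl.gen := fun X Y h => by
  refine ext_coeff fun i => pl.fst_injective ?_
  have := congrArg (fun P => P.coeff i) h
  simp only [coeff_gen] at this
  exact this

theorem ord_gen (X : DiffOp pl.deriv) : (pl.gen X).ord = X.ord :=
  Polynomial.natDegree_map_eq_of_injective pl.fst_injective _

theorem ord_red_le (X : DiffOp pl.deriv) : (pl.red X).ord ≤ (pl.gen X).ord := by
  rw [ord_gen]
  exact Polynomial.natDegree_map_le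

/-- Beyond the order of `P` the residues `b i` are forced to be zero, so finitely many pairs make up
the lift. -/
theorem exists_lift {P : DiffOp δ} {b : ℕ → K} (h : ∀ i, (P.coeff i, b i) ∈ pl.graph) :
    ∃ X, pl.gen X = P ∧ ∀ i, (pl.red X).coeff i = b i := by
  let q : (pl.graph)[X] :=
    ∑ i ∈ Finset.range (P.ord + 1), Polynomial.monomial i (⟨(P.coeff i, b i), h i⟩ : pl.graph)
  have hz : ∀ i, ¬ i < P.ord + 1 → P.coeff i = 0 := fun i hi =>
    coeff_eq_zero_of_ord_lt (by omega)
  have hq : ∀ i, q.coeff i = ⟨(P.coeff i, b i), h i⟩ := by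
    intro i
    simp only [q, Polynomial.finsetSum_coeff, Polynomial.coeff_monomial, Finset.sum_ite_eq',
      Finset.mem_range]
    split_ifs with hi
    · rfl
    · have h1 := hz i hi
      have h2 := h i
      rw [h1] at h2
      refine Subtype.ext (Prod.ext h1.symm (pl.eq_zero h2).symm)
  refine ⟨ofPoly _ q, ext_coeff fun i => ?_, fun i => ?_⟩
  · rw [coeff_gen, coeff_ofPoly, hq]
  · rw [coeff_red, coeff_ofPoly, hq]

/-- The coefficients of the operator belong to the residue field. -/
def Fixed (P : DiffOp δ) : Prop := ∀ i, (P.coeff i, P.coeff i) ∈ pl.graph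

variable {pl}

theorem Fixed.exists_lift {P : DiffOp δ} (h : pl.Fixed P) : ∃ X, pl.gen X = P ∧ pl.red X = P := by
  obtain ⟨X, h1, h2⟩ := pl.exists_lift h
  exact ⟨X, h1, ext_coeff h2⟩

variable (pl)

theorem fixed_red (X : DiffOp pl.deriv) : pl.Fixed (pl.red X) := fun i => pl.idem (pl.coeff_mem X i)

/-- A nonzero operator can be scaled by a constant to have a nonzero reduction. -/
theorem exists_primitive_operator {P : DiffOp δ} (hP : P ≠ 0) :
    ∃ c, c ≠ 0 ∧ δ c = 0 ∧ ∃ X, pl.gen X = c • P ∧ pl.red X ≠ 0 := by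
  have ha : (fun i : Fin (P.ord + 1) => P.coeff i) ≠ 0 := fun h =>
    coeff_ord_ne_zero hP (congrFun h (Fin.last _))
  obtain ⟨c, hc0, hc, b, hb, h⟩ := pl.exists_primitive ha
  obtain ⟨X, h1, h2⟩ := pl.exists_lift (P := c • P)
    (b := fun i => if hi : i < P.ord + 1 then b ⟨i, hi⟩ else 0) (by
      intro i
      rw [coeff_smul]
      split_ifs with hi
      · exact h ⟨i, hi⟩
      · rw [coeff_eq_zero_of_ord_lt (show P.ord < i by omega), mul_zero]
        exact pl.zero_mem)
  refine ⟨c, hc0, hc, X, h1, fun h0 => hb (funext fun i => ?_)⟩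
  have := h2 i
  rw [h0, coeff_zero, dif_pos i.2] at this
  exact this.symm

section Reduces

variable {B : DiffOp δ}

/-- The reduction of elements of a cyclic module defined over the residue field, as a relation. -/
def Reduces (v w : Cyc B) : Prop := ∃ X, DiffOp.mk B (pl.gen X) = v ∧ DiffOp.mk B (pl.red X) = w

variable {pl}

theorem Reduces.add {v w v' w' : Cyc B} : pl.Reduces v w → pl.Reduces v' w' →
    pl.Reduces (v + v') (w + w') := by
  rintro ⟨X, rfl, rfl⟩ ⟨Y, rfl, rfl⟩
  exact ⟨X + Y, by simp, by simp⟩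

theorem Reduces.smul {v w : Cyc B} (X : DiffOp pl.deriv) : pl.Reduces v w →
    pl.Reduces (pl.gen X • v) (pl.red X • w) := by
  rintro ⟨Y, rfl, rfl⟩
  exact ⟨X * Y, by rw [map_mul]; rfl, by rw [map_mul]; rfl⟩

theorem Reduces.smul_coeff {a b : K} {v w : Cyc B} (h : (a, b) ∈ pl.graph) :
    pl.Reduces v w → pl.Reduces (a • v) (b • w) := by
  intro hvw
  obtain ⟨X, h1, h2⟩ := pl.exists_lift (P := const δ a) (b := fun i => if i = 0 then b else 0) (by
    intro i
    simp only [const, coeff_ofPoly, Polynomial.coeff_C]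
    split_ifs
    · exact h
    · exact pl.zero_mem)
  have h3 : pl.red X = const δ b := by
    refine ext_coeff fun i => ?_
    simp [h2, const, Polynomial.coeff_C]
  have := hvw.smul X
  have e : ∀ (c : K) (w : Cyc B), c • w = const δ c • w := fun c w => by
    rw [← one_smul (DiffOp δ) w, ← smul_assoc, smul_eq_const_mul, smul_smul, mul_one]
  rwa [h1, h3, ← e, ← e] at this

theorem Reduces.sum {ι : Type*} (s : Finset ι) {v w : ι → Cyc B}
    (h : ∀ i ∈ s, pl.Reduces (v i) (w i)) : pl.Reduces (∑ i ∈ s, v i) (∑ i ∈ s, w i) := by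
  classical
  induction s using Finset.induction_on with
  | empty => exact ⟨0, by simp, by simp⟩
  | insert a s ha ih =>
    rw [Finset.sum_insert ha, Finset.sum_insert ha]
    exact (h a (Finset.mem_insert_self _ _)).add
      (ih fun i hi => h i (Finset.mem_insert_of_mem hi))

/-- Reduction is single-valued. `B` lifts to a monic operator over the graph, so division by it
stays integral; an integral operator in D B is therefore an integral multiple of the lift, and it
reduces to a multiple of `B`. -/
theorem Reduces.eq_zero (hB : B.Monic) (hf : pl.Fixed B) {w : Cyc B} (h : pl.Reduces 0 w) :
    w = 0 := by
  obtain ⟨X, hX, rfl⟩ := h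
  obtain ⟨BG, h1, h2⟩ := hf.exists_lift
  have hBG : BG.Monic := by
    rw [monic_iff]
    apply pl.fst_injective
    have := pl.coeff_gen BG BG.ord
    rw [← pl.ord_gen, h1, monic_iff.mp hB] at this
    rw [map_one, ← pl.ord_gen, h1]
    exact this.symm
  obtain ⟨Y, R, rfl, hR⟩ := exists_eq_mul_add_of_monic hBG X
  have hR0 : pl.gen R = 0 := by
    refine eq_zero_of_mem_span (B := B) (fun i hi => ?_) ?_
    · rw [coeff_gen, hR i (by rwa [← pl.ord_gen, h1])]
      rfl
    · have h3 := mk_eq_zero.mp hX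
      rw [map_add, map_mul, h1] at h3
      exact (Submodule.add_mem_iff_right _
        (Ideal.mul_mem_left _ _ (Ideal.mem_span_singleton_self _))).mp h3
  have : R = 0 := pl.gen_injective (by rw [hR0, map_zero])
  rw [mk_eq_zero, this, add_zero, map_mul, h2]
  exact Ideal.mul_mem_left _ _ (Ideal.mem_span_singleton_self _)

/-- If `X` annihilates an element then its reduction annihilates the reduction. -/
theorem Reduces.red_smul_eq_zero (hB : B.Monic) (hf : pl.Fixed B) {v w : Cyc B}
    (h : pl.Reduces v w) {X : DiffOp pl.deriv} (hX : pl.gen X • v = 0) : pl.red X • w = 0 := by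
  have := h.smul X
  rw [hX] at this
  exact this.eq_zero hB hf

end Reduces

end DiffPlace

/-! ### Reduction of independent vectors, endomorphisms and simple modules. -/

namespace DiffPlace

open DiffOp

variable {k K : Type*} [Field k] [Field K] [Algebra k K] {δ : Derivation k K K} (pl : DiffPlace δ)

/-- A subspace over the constants contains as many integral vectors with independent reductions as
its dimension allows. -/
theorem exists_echelon {ι : Type*} [Finite ι] (a : ℕ) (V : Submodule (constants δ) (ι → constants δ))
    (h : a ≤ Module.finrank (constants δ) V) :
    ∃ y z : Fin a → ι → constants δ, (∀ l, y l ∈ V) ∧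
      (∀ l s, ((y l s : K), (z l s : K)) ∈ pl.graph) ∧ LinearIndependent (constants δ) z := by
  have := Fintype.ofFinite ι
  induction a generalizing V with
  | zero => exact ⟨Fin.elim0, Fin.elim0, fun l => l.elim0, fun l => l.elim0,
      linearIndependent_empty_type⟩
  | succ a ih =>
    have hV : V ≠ ⊥ := by
      rintro rfl
      simp at h
    obtain ⟨x, hxV, hx0⟩ := Submodule.exists_mem_ne_zero_of_ne_bot hV
    have hx : (fun s => (x s : K)) ≠ 0 := fun h0 =>
      hx0 (funext fun s => Subtype.ext (congrFun h0 s))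
    obtain ⟨c, hc0, hc, b, hb, hcb⟩ := pl.exists_primitive hx
    -- The coordinate `s` is a pivot: the vectors of `V` vanishing at `s` form a subspace of
    -- codimension at most one, and their residues vanish at `s`, unlike the residue `b`.
    obtain ⟨s, hs⟩ := Function.ne_iff.mp hb
    have hbc : ∀ i, δ (b i) = 0 := fun i =>
      pl.deriv_eq_zero (hcb i) (by rw [Derivation.leibniz, hc, show δ (x i : K) = 0 from (x i).2]; simp)
    let z₀ : ι → constants δ := fun i => ⟨b i, hbc i⟩
    let c' : constants δ := ⟨c, hc⟩
    set W := LinearMap.ker (LinearMap.proj (R := constants δ) (φ := fun _ : ι => constants δ) s)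
    have hVW : a ≤ Module.finrank (constants δ) (V ⊓ W : Submodule (constants δ) (ι → constants δ)) := by
      have h1 := Submodule.finrank_sup_add_finrank_inf_eq V W
      have h2 := Submodule.finrank_le (V ⊔ W)
      have h3 := LinearMap.finrank_range_add_finrank_ker
        (LinearMap.proj (R := constants δ) (φ := fun _ : ι => constants δ) s)
      have h4 := Submodule.finrank_le (LinearMap.range
        (LinearMap.proj (R := constants δ) (φ := fun _ : ι => constants δ) s))
      rw [Module.finrank_self] at h4
      change _ + Module.finrank (constants δ) W = _ at h3
      omega
    obtain ⟨y, z, hy, hyz, hz⟩ := ih _ hVW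
    refine ⟨Fin.cons (c' • x) y, Fin.cons z₀ z, ?_, ?_, ?_⟩
    · intro l
      refine Fin.cases ?_ (fun l => ?_) l
      · exact V.smul_mem _ hxV
      · exact (hy l).1
    · intro l i
      refine Fin.cases ?_ (fun l => ?_) l
      · exact hcb i
      · exact hyz l i
    · rw [linearIndependent_finCons]
      refine ⟨hz, fun hmem => hs ?_⟩
      have hle : Submodule.span (constants δ) (Set.range z) ≤ W := by
        rw [Submodule.span_le]
        rintro _ ⟨l, rfl⟩
        have h1 := hyz l s
        have h2 : y l s = 0 := (hy l).2
        rw [h2] at h1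
        exact Subtype.ext (pl.eq_zero h1)
      exact congrArg Subtype.val (hle hmem : z₀ s = 0)

variable {pl} {B : DiffOp δ}

/-- Elements that are independent over the constants can be recombined so that their reductions
are independent. -/
theorem exists_reduces_linearIndependent [CharZero K] (hB : B.Monic) {t : K} (ht : δ t = 1)
    (htG : (t, t) ∈ pl.graph)
    (hK : ∀ a : K, ∃ p q : (constants δ)[X], Polynomial.aeval t q ≠ 0 ∧
      a * Polynomial.aeval t q = Polynomial.aeval t p)
    {ι : Type*} [Finite ι] {v : ι → Cyc B} (hv : LinearIndependent (constants δ) v) :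
    ∃ u w : ι → Cyc B, (∀ i, u i ∈ Submodule.span (constants δ) (Set.range v)) ∧
      (∀ i, pl.Reduces (u i) (w i)) ∧ LinearIndependent (constants δ) w := by
  have := Fintype.ofFinite ι
  choose X hX hX0 using fun i => exists_mk_eq hB (v i)
  obtain ⟨p, q, hq, hpq⟩ := exists_common_denominator hK
    (fun s : ι × Fin B.ord => (X s.1).coeff s.2)
  obtain ⟨c, hc0, hc, b, hb, hcb⟩ := pl.scale hq
  -- Scaled by the constant `c`, the common denominator becomes a unit with residue `b`, so its
  -- inverse has residue b⁻¹.
  set g := (c * Polynomial.aeval t q)⁻¹ with hg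
  have hgG : (g, b⁻¹) ∈ pl.graph := pl.inv_mem hcb hb
  obtain ⟨e, he⟩ : ∃ e, ∀ s, (p s).natDegree < e := by
    refine ⟨Finset.univ.sup (fun s => (p s).natDegree) + 1, fun s => Nat.lt_succ_of_le ?_⟩
    exact Finset.le_sup (f := fun s => (p s).natDegree) (Finset.mem_univ s)
  -- All `v i` lie in the C-span of the finitely many g tˡ ∂ʲ, which reduce to b⁻¹ tˡ ∂ʲ. This turns
  -- the problem into one about coordinate vectors over C.
  let E : K → Fin B.ord × Fin e → Cyc B := fun g s =>
    (g * t ^ (s.2 : ℕ)) • DiffOp.mk B (del δ ^ (s.1 : ℕ))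
  have hEred : ∀ s, pl.Reduces (E g s) (E b⁻¹ s) := fun s =>
    Reduces.smul_coeff (pl.mul_mem hgG (pl.pow_mem htG _)) ⟨del _ ^ (s.1 : ℕ), by
      rw [map_pow]
      congr 2
      ext i
      simp [coeff_gen, del, Polynomial.coeff_X, apply_ite], by
      rw [map_pow]
      congr 2
      ext i
      simp [coeff_red, del, Polynomial.coeff_X, apply_ite]⟩
  have hE : ∀ (g : K) (x : Fin B.ord × Fin e → constants δ),
      Fintype.linearCombination (constants δ) (E g) x
        = DiffOp.mk B (∑ j : Fin B.ord, (∑ l : Fin e, (x (j, l) : K) * (g * t ^ (l : ℕ))) •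
          del δ ^ (j : ℕ)) := by
    intro g x
    rw [Fintype.linearCombination_apply, Fintype.sum_prod_type]
    change _ = (Submodule.mkQ (Ideal.span {B})) _
    rw [map_sum]
    refine Finset.sum_congr rfl fun j _ => ?_
    rw [Finset.sum_smul, map_sum]
    refine Finset.sum_congr rfl fun l _ => ?_
    rw [mul_smul]
    rfl
  set f := Fintype.linearCombination (constants δ) (E g) with hf
  set f' := Fintype.linearCombination (constants δ) (E b⁻¹) with hf'
  -- The reduced family is still C-independent because t is transcendental over the constants; hence
  -- independent coordinate vectors yield independent elements of `Cyc B`.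
  have hinj : Function.Injective f' := by
    rw [← LinearMap.ker_eq_bot, LinearMap.ker_eq_bot']
    intro x hx
    rw [hE, mk_eq_zero] at hx
    have hsum : ∀ i, (∑ j : Fin B.ord, (∑ l : Fin e, (x (j, l) : K) * (b⁻¹ * t ^ (l : ℕ))) •
        del δ ^ (j : ℕ)).coeff i
        = ∑ j : Fin B.ord, (∑ l : Fin e, (x (j, l) : K) * (b⁻¹ * t ^ (l : ℕ))) *
          if i = j then 1 else 0 := by
      intro i
      simp only [coeff_sum, coeff_smul, coeff_del_pow]
    have hz := eq_zero_of_mem_span (fun i hi => by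
      rw [hsum]
      refine Finset.sum_eq_zero fun j _ => ?_
      rw [if_neg (by have := j.2; omega), mul_zero]) hx
    funext ⟨j, l⟩
    have h1 := hsum j
    rw [hz, coeff_zero, Finset.sum_eq_single j (fun j' _ hj' => by
      rw [if_neg (fun h => hj' (Fin.ext h.symm)), mul_zero]) (by simp), if_pos rfl, mul_one] at h1
    have h2 : Polynomial.aeval t (∑ l : Fin e, Polynomial.monomial (l : ℕ) (x (j, l))) = 0 := by
      rw [map_sum]
      simp only [Polynomial.aeval_monomial]
      have h3 : b⁻¹ * ∑ l : Fin e, (x (j, l) : K) * t ^ (l : ℕ) = 0 := by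
        rw [h1, Finset.mul_sum]
        exact Finset.sum_congr rfl fun l _ => by ring
      exact (mul_eq_zero.mp h3).resolve_left (inv_ne_zero hb)
    have h4 := congrArg (fun p => p.coeff (l : ℕ)) (eq_zero_of_aeval_eq_zero ht h2)
    simp only [Polynomial.finsetSum_coeff, Polynomial.coeff_monomial, Polynomial.coeff_zero] at h4
    rw [Finset.sum_eq_single l (fun l' _ hl' => by
      rw [if_neg (fun h => hl' (Fin.ext h))]) (by simp), if_pos rfl] at h4
    exact h4
  have hvf : ∀ i, ∃ x, f x = v i := by
    intro i
    refine ⟨fun s => ⟨c, hc⟩ * (p (i, s.1)).coeff s.2, ?_⟩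
    rw [hE, ← hX]
    congr 1
    have h1 : ∀ j, B.ord ≤ j → (X i).coeff j = 0 := hX0 i
    rw [Finset.sum_fin_eq_sum_range]
    refine ext_coeff fun j => ?_
    rw [coeff_sum]
    by_cases hj : j < B.ord
    · rw [Finset.sum_eq_single j]
      · rw [dif_pos hj, coeff_smul, coeff_del_pow, if_pos rfl, mul_one]
        have h2 := hpq (i, ⟨j, hj⟩)
        have h3 : (X i).coeff j = Polynomial.aeval t (p (i, ⟨j, hj⟩)) * c * g := by
          rw [← h2, hg]
          field_simp
        rw [h3, Polynomial.aeval_eq_sum_range' (he _), Finset.sum_mul, Finset.sum_mul,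
          Finset.sum_range]
        refine Finset.sum_congr rfl fun l _ => ?_
        rw [Subfield.smul_def]
        simp only [Subfield.coe_mul, smul_eq_mul]
        ring
      · intro l hl hlj
        rw [dif_pos (Finset.mem_range.mp hl), coeff_smul, coeff_del_pow, if_neg (Ne.symm hlj),
          mul_zero]
      · intro h
        exact absurd (Finset.mem_range.mpr hj) h
    · rw [h1 j (not_lt.mp hj), Finset.sum_eq_zero]
      intro l hl
      have := Finset.mem_range.mp hl
      rw [dif_pos this, coeff_smul, coeff_del_pow, if_neg (by simp only; omega), mul_zero]
  set U := Submodule.span (constants δ) (Set.range v)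
  have hUcard : Module.finrank (constants δ) U = Fintype.card ι := finrank_span_eq_card hv
  -- Since f maps f⁻¹(U) onto U, the dimension of f⁻¹(U) is at least that of U; injectivity of f is
  -- not needed.
  have hmap : (U.comap f).map f = U := by
    rw [Submodule.map_comap_eq, inf_eq_right, Submodule.span_le]
    rintro _ ⟨i, rfl⟩
    exact hvf i
  have hdim : Fintype.card ι ≤ Module.finrank (constants δ) (U.comap f) := by
    rw [← hUcard]
    conv_lhs => rw [← hmap]
    exact Submodule.finrank_map_le f _
  obtain ⟨y, z, hy, hyz, hz⟩ := pl.exists_echelon _ _ hdim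
  let ε := Fintype.equivFin ι
  refine ⟨fun i => f (y (ε i)), fun i => f' (z (ε i)), fun i => hy _, fun i => ?_, ?_⟩
  · simp only [hf, hf', Fintype.linearCombination_apply]
    exact Reduces.sum _ fun s _ => Reduces.smul_coeff (hyz _ s) (hEred s)
  · exact (hz.map' f' (LinearMap.ker_eq_bot.mpr hinj)).comp _ ε.injective

/-- An endomorphism of a simple module that is algebraic over the algebraically closed field `k`
is a scalar. -/
theorem _root_.DiffOp.exists_eq_smul_of_aeval [IsAlgClosed k] {T : Type*} [AddCommGroup T]
    [Module (DiffOp δ) T] [Module K T] [IsScalarTower K (DiffOp δ) T] [IsSimpleModule (DiffOp δ) T]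
    (θ : T →ₗ[DiffOp δ] T) {e : T} (he : e ≠ 0) {r : k[X]} (hr : r ≠ 0)
    (h : Polynomial.aeval (θ.restrictScalars K) (r.map (algebraMap k K)) e = 0) :
    ∃ x : k, ∀ v, θ v = algebraMap k K x • v := by
  induction hn : r.natDegree using Nat.strong_induction_on generalizing r with
  | _ n ih =>
    by_cases hd : r.degree = 0
    · rw [Polynomial.eq_C_of_degree_eq_zero hd, Polynomial.map_C, Polynomial.aeval_C,
        Module.algebraMap_end_apply] at h
      have h1 : r.coeff 0 ≠ 0 := fun h0 => hr (by
        rw [Polynomial.eq_C_of_degree_eq_zero hd, h0, map_zero])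
      rcases smul_eq_zero.mp h with h2 | h2
      · exact absurd ((map_eq_zero _).mp h2) h1
      · exact absurd h2 he
    · obtain ⟨x, hx⟩ := IsAlgClosed.exists_root r hd
      obtain ⟨s, rfl⟩ := Polynomial.dvd_iff_isRoot.mpr hx
      have hs : s ≠ 0 := right_ne_zero_of_mul hr
      -- Either s already annihilates e at θ and the degree drops, or s(θ) e is a nonzero vector in
      -- the kernel of θ − x, which is then zero by Schur's lemma.
      by_cases hse : Polynomial.aeval (θ.restrictScalars K) (s.map (algebraMap k K)) e = 0
      · refine ih _ ?_ hs hse rfl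
        rw [← hn, Polynomial.natDegree_mul (Polynomial.X_sub_C_ne_zero x) hs,
          Polynomial.natDegree_X_sub_C]
        omega
      · refine ⟨x, ?_⟩
        set w := Polynomial.aeval (θ.restrictScalars K) (s.map (algebraMap k K)) e
        let η := θ - constEnd T (⟨algebraMap k K x, δ.map_algebraMap x⟩ : constants δ)
        have hη : η w = 0 := by
          rw [Polynomial.map_mul, map_mul, Module.End.mul_apply] at h
          simpa [η] using h
        rcases LinearMap.injective_or_eq_zero η with h1 | h1
        · exact absurd (h1 (hη.trans (map_zero η).symm)) hse
        · intro v
          exact sub_eq_zero.mp (LinearMap.congr_fun h1 v)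

/-- The endomorphisms of a simple cyclic module defined over the residue field are constants. -/
theorem exists_constants_smul [IsAlgClosed k] [CharZero K] (hB : B.Monic) (hf : pl.Fixed B)
    (hirr : Irreducible B) {t : K} (ht : δ t = 1) (htG : (t, t) ∈ pl.graph)
    (hK : ∀ a : K, ∃ p q : (constants δ)[X], Polynomial.aeval t q ≠ 0 ∧
      a * Polynomial.aeval t q = Polynomial.aeval t p)
    (θ : Cyc B →ₗ[DiffOp δ] Cyc B) : ∃ c : constants δ, θ = constEnd _ c := by
  have := isSimpleModule_cyc hirr
  have := finite_cyc hB
  set e : Cyc B := DiffOp.mk B 1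
  have hX : ∀ X : DiffOp δ, DiffOp.mk B X = X • e := fun X => by
    change _ = DiffOp.mk B (X * 1)
    rw [mul_one]
  have he : e ≠ 0 := by
    intro h0
    have := IsSimpleModule.nontrivial (DiffOp δ) (Cyc B)
    obtain ⟨v, hv⟩ := exists_ne (0 : Cyc B)
    obtain ⟨X, rfl⟩ := Submodule.Quotient.mk_surjective _ v
    exact hv ((hX X).trans (by rw [h0, smul_zero]))
  have hBe : B • e = 0 := by
    rw [← hX, mk_eq_zero]
    exact Ideal.mem_span_singleton_self _
  suffices h : ∃ c : constants δ, c • e = θ e by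
    obtain ⟨c, hc⟩ := h
    refine ⟨c, LinearMap.ext fun v => ?_⟩
    obtain ⟨X, rfl⟩ := Submodule.Quotient.mk_surjective _ v
    change θ (DiffOp.mk B X) = constEnd _ c (DiffOp.mk B X)
    rw [hX, map_smul, map_smul, ← hc]
    rfl
  -- Otherwise e and θ e could be recombined to have C-independent residues, again killed by `B`.
  -- The contradiction is that each such residue is a constant multiple of e.
  by_contra! hne
  have hli : LinearIndependent (constants δ) ![e, θ e] := (LinearIndependent.pair_iff' he).mpr hne
  obtain ⟨u, w, hu, huw, hw⟩ := exists_reduces_linearIndependent (pl := pl) hB ht htG hK hli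
  have hBu : ∀ i, B • u i = 0 := by
    intro i
    refine Submodule.span_induction (p := fun x _ => B • x = 0) ?_ (smul_zero _) ?_ ?_ (hu i)
    · rintro _ ⟨j, rfl⟩
      fin_cases j
      · exact hBe
      · change B • θ e = 0
        rw [← map_smul, hBe, map_zero]
    · intro x y _ _ hx hy
      rw [smul_add, hx, hy, add_zero]
    · intro c x _ hx
      rw [Subfield.smul_def, smul_const_smul c.2, hx, smul_zero]
  have key : ∀ i, ∃ c : constants δ, w i = c • e := by
    intro i
    obtain ⟨BG, hB1, hB2⟩ := hf.exists_lift
    have hBw : B • w i = 0 := by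
      have := (huw i).red_smul_eq_zero hB hf (X := BG) (by rw [hB1, hBu])
      rwa [hB2] at this
    obtain ⟨X, -, hXw⟩ := huw i
    obtain ⟨W, hW1, hW2⟩ := (pl.fixed_red X).exists_lift
    -- `w i` is killed by `B` and represented by an operator over the residue field, so e ↦ w i
    -- defines an endomorphism whose powers send e to vectors that are their own reductions.
    let θ' : Cyc B →ₗ[DiffOp δ] Cyc B := Submodule.liftQ (Ideal.span {B})
      (LinearMap.toSpanSingleton (DiffOp δ) _ (w i)) (by
        rw [Ideal.span_singleton_le_iff_mem]
        exact hBw)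
    have hθe : θ' e = w i := one_smul (DiffOp δ) (w i)
    have hpow : ∀ n, (θ' ^ n) e = DiffOp.mk B (pl.red X ^ n) := by
      intro n
      induction n with
      | zero => rfl
      | succ n ih =>
        rw [pow_succ', Module.End.mul_apply, ih, pow_succ]
        change (pl.red X ^ n) • w i = _
        rw [← hXw]
        rfl
    have hred : ∀ n, pl.Reduces ((θ' ^ n) e) ((θ' ^ n) e) := fun n =>
      ⟨W ^ n, by rw [hpow, map_pow, hW1], by rw [hpow, map_pow, hW2]⟩
    set p := minpoly K (θ'.restrictScalars K)
    have hp0 : p ≠ 0 := minpoly.ne_zero (Algebra.IsIntegral.isIntegral _)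
    have ha : (fun n : Fin (p.natDegree + 1) => p.coeff n) ≠ 0 := fun h0 =>
      hp0 (Polynomial.leadingCoeff_eq_zero.mp (congrFun h0 (Fin.last _)))
    -- The minimal polynomial has constant coefficients. After scaling, their residues lie in k and
    -- are not all zero, which gives a nonzero polynomial over k annihilating e at θ'.
    obtain ⟨c, hc0, hc, b, hb, hcb⟩ := pl.exists_primitive ha
    choose x hx using fun n => pl.const_mem (hcb n) (by
      rw [Derivation.leibniz, hc, deriv_coeff_minpoly]; simp)
    have hsum : ∑ n : Fin (p.natDegree + 1), b n • (θ' ^ (n : ℕ)) e = 0 := by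
      have h1 := LinearMap.congr_fun (minpoly.aeval K (θ'.restrictScalars K)) e
      rw [Polynomial.aeval_eq_sum_range, LinearMap.sum_apply, Finset.sum_range] at h1
      have h2 : pl.Reduces (∑ n : Fin (p.natDegree + 1), (c * p.coeff n) • (θ' ^ (n : ℕ)) e)
          (∑ n : Fin (p.natDegree + 1), b n • (θ' ^ (n : ℕ)) e) :=
        Reduces.sum _ fun n _ => (hred n).smul_coeff (hcb n)
      have h3 : ∑ n : Fin (p.natDegree + 1), (c * p.coeff n) • (θ' ^ (n : ℕ)) e = 0 := by
        simp only [mul_smul, ← Finset.smul_sum]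
        rw [show ∑ n : Fin (p.natDegree + 1), p.coeff n • (θ' ^ (n : ℕ)) e = 0 from ?_, smul_zero]
        rw [← LinearMap.zero_apply (σ₁₂ := RingHom.id K) (M₂ := Cyc B) e, ← h1]
        refine Finset.sum_congr rfl fun n _ => ?_
        rw [LinearMap.smul_apply, restrictScalars_pow_apply]
      rw [h3] at h2
      exact h2.eq_zero hB hf
    obtain ⟨y, hy⟩ := exists_eq_smul_of_aeval θ' he
      (r := ∑ n : Fin (p.natDegree + 1), Polynomial.monomial (n : ℕ) (x n)) (by
        intro h0
        refine hb (funext fun n => ?_)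
        have h4 := congrArg (fun p => p.coeff (n : ℕ)) h0
        simp only [Polynomial.finsetSum_coeff, Polynomial.coeff_monomial,
          Polynomial.coeff_zero] at h4
        rw [Finset.sum_eq_single n (fun l' _ hl' => by
          rw [if_neg (fun h => hl' (Fin.ext h))]) (by simp), if_pos rfl] at h4
        rw [hx, h4, map_zero]
        rfl) (by
        rw [Polynomial.map_sum, map_sum, LinearMap.sum_apply, ← hsum]
        refine Finset.sum_congr rfl fun n _ => ?_
        rw [Polynomial.map_monomial, Polynomial.aeval_monomial, Module.End.mul_apply,
          Module.algebraMap_end_apply, restrictScalars_pow_apply, hx])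
    exact ⟨⟨algebraMap k K y, δ.map_algebraMap y⟩, by rw [← hθe, hy]; rfl⟩
  obtain ⟨c₀, h0⟩ := key 0
  obtain ⟨c₁, h1⟩ := key 1
  have h2 := LinearIndependent.pair_iff.mp
    (show LinearIndependent (constants δ) ![w 0, w 1] by
      convert hw using 1
      ext i
      fin_cases i <;> rfl) c₁ (-c₀) (by
    rw [h0, h1, smul_smul, smul_smul, ← add_smul]
    rw [show c₁ * c₀ + -c₀ * c₁ = 0 by ring, zero_smul])
  exact hw.ne_zero 0 (by rw [h0, neg_eq_zero.mp h2.2, zero_smul])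

variable (pl) in
/-- A factorization of a monic operator over the residue field can be scaled and reduced. -/
theorem exists_reduced_factors {L A₁ A₂ : DiffOp δ} (hL : L.Monic) (hf : pl.Fixed L)
    (h : L = A₁ * A₂) : ∃ R₁ R₂ : DiffOp δ, pl.Fixed R₁ ∧ pl.Fixed R₂ ∧ L = R₁ * R₂ ∧
      R₁.ord ≤ A₁.ord ∧ R₂.ord ≤ A₂.ord := by
  have hA₁ : A₁ ≠ 0 := by rintro rfl; exact hL.ne_zero (by rw [h, zero_mul])
  have hA₂ : A₂ ≠ 0 := by rintro rfl; exact hL.ne_zero (by rw [h, mul_zero])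
  have hconst : ∀ (a : K) (P : DiffOp δ), a • P = const δ a * P := smul_eq_const_mul
  obtain ⟨a, ha0, ha, X₂, hX₂, hX₂0⟩ := pl.exists_primitive_operator hA₂
  have hinv : const δ a⁻¹ * const δ a = 1 := by
    rw [← smul_eq_const_mul]
    ext i
    simp only [coeff_smul, const, coeff_ofPoly, Polynomial.coeff_C, coeff_one]
    split_ifs
    · exact inv_mul_cancel₀ ha0
    · exact mul_zero _
  have hac : δ a⁻¹ = 0 := (constants δ).inv_mem ha
  -- The factor a⁻¹ compensates for the scaling of A₂ by a, so the two integral factors multiply to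
  -- b L.
  obtain ⟨b, hb0, hb, X₁, hX₁, hX₁0⟩ := pl.exists_primitive_operator
    (P := a⁻¹ • A₁) (fun h0 => hA₁ (by
      rw [← one_smul K A₁, ← mul_inv_cancel₀ ha0, mul_smul, h0, smul_zero]))
  obtain ⟨LG, hL1, hL2⟩ := hf.exists_lift
  have hgen : pl.gen (X₁ * X₂) = b • L := by
    rw [map_mul, hX₁, hX₂, h, smul_mul_assoc, hconst a⁻¹, hconst a, ← const_mul_comm hac,
      mul_assoc, ← mul_assoc (const δ a⁻¹), hinv, one_mul]
  have hbG := pl.coeff_mem (X₁ * X₂) L.ord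
  rw [hgen, coeff_smul, monic_iff.mp hL, mul_one] at hbG
  set β := (pl.red (X₁ * X₂)).coeff L.ord
  have hlift : ∀ i, ((b • L).coeff i, (β • L).coeff i) ∈ pl.graph := fun i => by
    rw [coeff_smul, coeff_smul]
    exact pl.mul_mem hbG (hf i)
  have hred : pl.red (X₁ * X₂) = β • L := by
    refine ext_coeff fun i => pl.unique (pl.coeff_mem (X₁ * X₂) i) ?_
    rw [hgen]
    exact hlift i
  -- Both reduced factors are nonzero and there are no zero divisors, so the scalar b is a unit of
  -- the valuation ring.
  have hβ : β ≠ 0 := by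
    intro h0
    rw [h0, zero_smul, map_mul] at hred
    exact (mul_ne_zero hX₁0 hX₂0) hred
  refine ⟨β⁻¹ • pl.red X₁, pl.red X₂, fun i => ?_, pl.fixed_red X₂, ?_, ?_, ?_⟩
  · rw [coeff_smul]
    exact pl.mul_mem (pl.inv_mem (pl.idem hbG) hβ) (pl.fixed_red X₁ i)
  · rw [smul_mul_assoc, ← map_mul, hred, smul_smul, inv_mul_cancel₀ hβ, one_smul]
  · rw [ord_smul (inv_ne_zero hβ)]
    refine (pl.ord_red_le X₁).trans_eq ?_
    rw [hX₁, ord_smul hb0, ord_smul (inv_ne_zero ha0)]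
  · refine (pl.ord_red_le X₂).trans_eq ?_
    rw [hX₂, ord_smul ha0]

variable (pl) in
/-- A simple module with an element annihilated by an operator over the residue field is defined
over the residue field. -/
theorem exists_cyc_equiv {T : Type*} [AddCommGroup T] [Module (DiffOp δ) T]
    [IsSimpleModule (DiffOp δ) T] {L : DiffOp δ} (hL : L ≠ 0) (hf : pl.Fixed L) {v : T}
    (hv : v ≠ 0) (hLv : L • v = 0) :
    ∃ B : DiffOp δ, B.Monic ∧ pl.Fixed B ∧ Irreducible B ∧ Nonempty (T ≃ₗ[DiffOp δ] Cyc B) := by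
  classical
  -- The order is minimized over all nonzero vectors of T at once, not for the given v: minimality
  -- is applied below to R₂ v as well.
  have hex : ∃ n, ∃ L : DiffOp δ, L ≠ 0 ∧ pl.Fixed L ∧ (∃ v : T, v ≠ 0 ∧ L • v = 0) ∧ L.ord = n :=
    ⟨_, L, hL, hf, ⟨v, hv, hLv⟩, rfl⟩
  obtain ⟨L, hL, hf, ⟨v, hv, hLv⟩, hn⟩ := Nat.find_spec hex
  have hmin : ∀ Q : DiffOp δ, Q ≠ 0 → pl.Fixed Q → (∃ v : T, v ≠ 0 ∧ Q • v = 0) →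
      L.ord ≤ Q.ord := fun Q h1 h2 h3 => by
    rw [hn]
    exact Nat.find_min' hex ⟨Q, h1, h2, h3, rfl⟩
  have hlc := coeff_ord_ne_zero hL
  set B := (L.coeff L.ord)⁻¹ • L with hBdef
  have hB : B.Monic := monic_smul hL
  have hBf : pl.Fixed B := fun i => by
    rw [hBdef, coeff_smul]
    exact pl.mul_mem (pl.inv_mem (hf _) hlc) (hf i)
  have hBv : B • v = 0 := by
    rw [hBdef, smul_eq_const_mul, mul_smul, hLv, smul_zero]
  have hBord : B.ord = L.ord := ord_smul (inv_ne_zero hlc) L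
  have hirr : Irreducible B := by
    refine ⟨fun hu => ?_, fun A₁ A₂ h => ?_⟩
    · obtain ⟨u, hu⟩ := hu
      apply hv
      rw [← one_smul (DiffOp δ) v, ← Units.inv_mul u, mul_smul, hu, hBv, smul_zero]
    · have hA₁ : A₁ ≠ 0 := by rintro rfl; exact hB.ne_zero (by rw [h, zero_mul])
      have hA₂ : A₂ ≠ 0 := by rintro rfl; exact hB.ne_zero (by rw [h, mul_zero])
      have hord := ord_mul hA₁ hA₂
      rw [← h, hBord] at hord
      obtain ⟨R₁, R₂, hR₁, hR₂, hR, ho₁, ho₂⟩ := pl.exists_reduced_factors hB hBf h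
      have hR₁0 : R₁ ≠ 0 := by rintro rfl; exact hB.ne_zero (by rw [hR, zero_mul])
      have hR₂0 : R₂ ≠ 0 := by rintro rfl; exact hB.ne_zero (by rw [hR, mul_zero])
      -- Whichever reduced factor kills a nonzero vector has order at least ord B; so has the
      -- original factor it comes from, and the other original factor has order zero.
      by_cases h2 : R₂ • v = 0
      · have := hmin R₂ hR₂0 hR₂ ⟨v, hv, h2⟩
        exact .inl (isUnit_of_ord_eq_zero hA₁ (by omega))
      · have := hmin R₁ hR₁0 hR₁ ⟨R₂ • v, h2, by rw [← mul_smul, ← hR, hBv]⟩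
        exact .inr (isUnit_of_ord_eq_zero hA₂ (by omega))
  refine ⟨B, hB, hBf, hirr, ?_⟩
  have := isSimpleModule_cyc hirr
  let φ : Cyc B →ₗ[DiffOp δ] T := Submodule.liftQ (Ideal.span {B})
    (LinearMap.toSpanSingleton (DiffOp δ) _ v) (by
      rw [Ideal.span_singleton_le_iff_mem]
      exact hBv)
  have hφ : φ ≠ 0 := fun h0 => hv (by
    have : φ (DiffOp.mk B 1) = v := one_smul _ _
    rw [← this, h0, LinearMap.zero_apply])
  exact ⟨(LinearEquiv.ofBijective φ (LinearMap.bijective_of_ne_zero hφ)).symm⟩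

end DiffPlace

/-! ### Similarity and semisimplicity in terms of cyclic modules. -/

namespace DiffOp

section Similarity

variable {k F : Type*} [CommRing k] [Field F] [Algebra k F] {δ : Derivation k F F}

theorem mk_eq_smul_mk_one (P X : DiffOp δ) : mk P X = X • mk P 1 := by
  change _ = mk P (X * 1)
  rw [mul_one]

theorem self_smul_mk_one (P : DiffOp δ) : P • mk P 1 = 0 := by
  rw [← mk_eq_smul_mk_one, mk_eq_zero]
  exact Ideal.mem_span_singleton_self _

/-- The homomorphism from a cyclic module sending the generator to a given element. -/
def cycLift {T : Type*} [AddCommGroup T] [Module (DiffOp δ) T] {P : DiffOp δ} (v : T)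
    (hv : P • v = 0) : Cyc P →ₗ[DiffOp δ] T :=
  Submodule.liftQ (Ideal.span {P}) (LinearMap.toSpanSingleton (DiffOp δ) _ v) (by
    rw [Ideal.span_singleton_le_iff_mem]
    exact hv)

@[simp] theorem cycLift_mk {T : Type*} [AddCommGroup T] [Module (DiffOp δ) T] {P : DiffOp δ} (v : T)
    (hv : P • v = 0) (X : DiffOp δ) : cycLift v hv (mk P X) = X • v := rfl

theorem cyc_hom_ext {T : Type*} [AddCommGroup T] [Module (DiffOp δ) T] {P : DiffOp δ}
    {f g : Cyc P →ₗ[DiffOp δ] T} (h : f (mk P 1) = g (mk P 1)) : f = g := by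
  refine LinearMap.ext fun v => ?_
  obtain ⟨X, rfl⟩ := Submodule.Quotient.mk_surjective _ v
  change f (mk P X) = g (mk P X)
  rw [mk_eq_smul_mk_one, map_smul, map_smul, h]

/-- Operators with isomorphic cyclic modules are similar. -/
theorem isSimilarTo_of_equiv {P P' : DiffOp δ} (hP : P.Monic) (hP' : P'.Monic)
    (f : Cyc P' ≃ₗ[DiffOp δ] Cyc P) : P'.IsSimilarTo P := by
  -- Similarity requires Q ≠ 0; should the representative be 0, P represents the same class.
  obtain ⟨Q, hQ0, hQ⟩ : ∃ Q : DiffOp δ, Q ≠ 0 ∧ mk P Q = f (mk P' 1) := by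
    obtain ⟨Q, hQ⟩ := Submodule.Quotient.mk_surjective _ (f (mk P' 1))
    by_cases h0 : Q = 0
    · refine ⟨P, hP.ne_zero, ?_⟩
      rw [← hQ, h0]
      exact mk_eq_zero.mpr (Ideal.mem_span_singleton_self P)
    · exact ⟨Q, h0, hQ⟩
  have hfX : ∀ X : DiffOp δ, f (mk P' X) = mk P (X * Q) := fun X => by
    rw [mk_eq_smul_mk_one, map_smul, ← hQ]
    rfl
  have hlc := coeff_ord_ne_zero hQ0
  have hP'Q : P' * Q ≠ 0 := mul_ne_zero hP'.ne_zero hQ0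
  refine ⟨Q, hQ0, ⟨monic_one, ⟨P, (mul_one P).symm⟩, ⟨Q, (mul_one Q).symm⟩, ?_⟩, hP',
    ((P' * Q).coeff (P' * Q).ord)⁻¹ • (P' * Q), (P' * Q).coeff (P' * Q).ord, ⟨monic_smul hP'Q, ?_,
      ?_⟩, ?_⟩
  · intro R hRP hRQ
    obtain ⟨X, hX⟩ := Submodule.Quotient.mk_surjective _ (f.symm (mk P 1))
    have h1 : mk P (1 - X * Q) = 0 := by
      have : f (mk P' X) = mk P 1 := (congrArg f hX).trans (f.apply_symm_apply _)
      rw [hfX] at this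
      exact sub_eq_zero.mpr this.symm
    rw [isRightFactor_iff] at hRP hRQ
    have h2 : (1 : DiffOp δ) ∈ Ideal.span {R} := by
      have h3 : Ideal.span {P} ≤ Ideal.span {R} := by rwa [Ideal.span_singleton_le_iff_mem]
      have := Ideal.add_mem _ (h3 (mk_eq_zero.mp h1)) (Ideal.mul_mem_left _ X hRQ)
      rwa [sub_add_cancel] at this
    obtain ⟨M, hM⟩ := Ideal.mem_span_singleton'.mp h2
    rw [(ord_eq_zero_of_mul_eq_one hM).2]
    exact Nat.zero_le _
  · rintro R (rfl | rfl)
    · rw [isRightFactor_iff, smul_eq_const_mul]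
      refine Ideal.mul_mem_left _ _ (mk_eq_zero.mp ?_)
      rw [← hfX, mk_eq_zero.mpr (Ideal.mem_span_singleton_self P'), map_zero]
    · exact ⟨_, by rw [← smul_mul_assoc]⟩
  -- If Y Q ∈ D P, then Y kills the image of the generator under the isomorphism, so Y ∈ D P'. Thus
  -- every common left multiple of P and Q is a left multiple of P' Q.
  · intro M hM hdvd
    obtain ⟨Y, rfl⟩ := hdvd Q (by simp)
    have hY : Y ∈ Ideal.span {P'} := by
      rw [← mk_eq_zero, ← f.map_eq_zero_iff, hfX, mk_eq_zero, ← isRightFactor_iff]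
      exact hdvd P (by simp)
    obtain ⟨Z, rfl⟩ := Ideal.mem_span_singleton'.mp hY
    have hZ : Z ≠ 0 := by
      rintro rfl
      exact hM.ne_zero (by simp)
    rw [ord_smul (inv_ne_zero (coeff_ord_ne_zero hP'Q)), mul_assoc, ord_mul hZ hP'Q]
    exact Nat.le_add_left _ _
  · rw [← smul_eq_const_mul, smul_smul, mul_inv_cancel₀ (coeff_ord_ne_zero hP'Q), one_smul]

/-- Completely reducible operators have semisimple cyclic modules. -/
theorem IsCompletelyReducible.isSemisimpleModule {P : DiffOp δ} (h : P.IsCompletelyReducible) :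
    IsSemisimpleModule (DiffOp δ) (Cyc P) := by
  obtain ⟨S, hS, hP, hdvd, hmin⟩ := h
  have := finite_cyc hP
  have : IsArtinian (DiffOp δ) (Cyc P) := isArtinian_of_tower F inferInstance
  -- It suffices that the Jacobson radical vanishes. A radical element lies in the kernel of every
  -- D/DP → D/DQ, Q ∈ S, so its representative of order below ord P is a common left multiple of S,
  -- hence zero.
  rw [IsArtinian.isSemisimpleModule_iff_jacobson, eq_bot_iff]
  intro v hv
  obtain ⟨X, rfl, hX⟩ := exists_mk_eq hP v
  rw [Module.jacobson, Submodule.mem_sInf] at hv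
  have hXQ : ∀ Q ∈ S, X ∈ Ideal.span {Q} := by
    intro Q hQ
    have := isSimpleModule_cyc (hS Q hQ)
    have hPQ : P • mk Q 1 = 0 := by
      rw [← mk_eq_smul_mk_one, mk_eq_zero, ← isRightFactor_iff]
      exact hdvd Q hQ
    have hsurj : Function.Surjective (cycLift (mk Q 1) hPQ) := fun y => by
      obtain ⟨Y, rfl⟩ := Submodule.Quotient.mk_surjective _ y
      exact ⟨mk P Y, (mk_eq_smul_mk_one Q Y).symm⟩
    have hmem := hv _ (LinearMap.isCoatom_ker_of_surjective hsurj)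
    rw [LinearMap.mem_ker, cycLift_mk, ← mk_eq_smul_mk_one, mk_eq_zero] at hmem
    exact hmem
  have hX0 : X = 0 := by
    by_contra h0
    have h1 := hmin _ (monic_smul h0) (fun Q hQ => by
      rw [isRightFactor_iff, smul_eq_const_mul]
      exact Ideal.mul_mem_left _ _ (hXQ Q hQ))
    rw [ord_smul (inv_ne_zero (coeff_ord_ne_zero h0))] at h1
    exact (ord_lt_of_coeff h0 hX).not_ge h1
  rw [hX0]
  exact Submodule.zero_mem _

/-- The cyclic modules of equal operators. -/
def castCyc {P Q : DiffOp δ} (h : P = Q) : Cyc P ≃ₗ[DiffOp δ] Cyc Q :=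
  Submodule.quotEquivOfEq _ _ (by rw [h])

@[simp] theorem castCyc_rfl {P : DiffOp δ} (v : Cyc P) : castCyc rfl v = v := by
  obtain ⟨X, rfl⟩ := Submodule.Quotient.mk_surjective _ v
  rfl

end Similarity

/-! ### Generators of products of simple modules. -/

section Density

variable {k K : Type*} [Field k] [Field K] [Algebra k K] {δ : Derivation k K K}
  {N : ℕ} {B : Fin N → DiffOp δ}

/-- The components of a generator of a product of cyclic modules, in copies of the same module, are
independent over the constants. -/
theorem linearIndependent_of_span_eq_top (hirr : ∀ i, Irreducible (B i)) {v : ∀ i, Cyc (B i)}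
    (hv : Submodule.span (DiffOp δ) {v} = ⊤) (b : DiffOp δ) :
    LinearIndependent (constants δ) (fun i : {i // B i = b} => castCyc i.2 (v i)) := by
  classical
  rw [Fintype.linearIndependent_iff]
  intro c hc j
  -- A relation among the components is a homomorphism Ψ that vanishes at the generator v, hence
  -- everywhere; restricting it to the factor `j` gives c j = 0.
  let Ψ : (∀ i, Cyc (B i)) →ₗ[DiffOp δ] Cyc b := ∑ i : {i // B i = b},
    (constEnd _ (c i)).comp ((castCyc i.2).toLinearMap.comp (LinearMap.proj i.1))
  have hΨ : ∀ x, Ψ x = ∑ i : {i // B i = b}, c i • castCyc i.2 (x i) := fun x => by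
    simp only [Ψ, LinearMap.sum_apply]
    rfl
  have hΨ0 : Ψ = 0 := by
    rw [← LinearMap.ker_eq_top, eq_top_iff, ← hv, Submodule.span_singleton_le_iff_mem,
      LinearMap.mem_ker, hΨ, hc]
  have := isSimpleModule_cyc (hirr j)
  have := IsSimpleModule.nontrivial (DiffOp δ) (Cyc (B j))
  obtain ⟨x, hx⟩ := exists_ne (0 : Cyc (B j))
  have h1 := hΨ (Pi.single j.1 x)
  rw [hΨ0, LinearMap.zero_apply, Finset.sum_eq_single j, Pi.single_eq_same] at h1
  · refine (smul_eq_zero.mp h1.symm).resolve_right fun h2 => hx ?_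
    exact (LinearEquiv.map_eq_zero_iff _).mp h2
  · intro i _ hij
    rw [Pi.single_eq_of_ne (fun h => hij (Subtype.ext h)), map_zero, smul_zero]
  · intro h
    exact absurd (Finset.mem_univ j) h

/-- An element of a product of simple modules with constant endomorphisms generates the product if
its components in copies of the same module are independent over the constants. -/
theorem span_eq_top_of_linearIndependent (hirr : ∀ i, Irreducible (B i))
    (hiso : ∀ i j, Nonempty (Cyc (B i) ≃ₗ[DiffOp δ] Cyc (B j)) → B i = B j)
    (hEnd : ∀ i (θ : Cyc (B i) →ₗ[DiffOp δ] Cyc (B i)), ∃ c : constants δ, θ = constEnd _ c)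
    {w : ∀ i, Cyc (B i)}
    (hw : ∀ j, LinearIndependent (constants δ)
      (fun i : {i // B i = B j} => castCyc i.2 (w i))) :
    Submodule.span (DiffOp δ) {w} = ⊤ := by
  classical
  by_contra hne
  -- A maximal submodule containing w has a simple quotient, isomorphic to some factor `Cyc (B j)`.
  -- The resulting map ψ kills w, vanishes on factors not isomorphic to that one and is given by
  -- constants on the others: a C-linear relation, which has to be trivial.
  obtain ⟨m, hm, hwm⟩ := (eq_top_or_exists_le_coatom (Submodule.span (DiffOp δ) {w})).resolve_left hne
  have hsimple := fun i => isSimpleModule_cyc (hirr i)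
  have : IsSimpleModule (DiffOp δ) ((∀ i, Cyc (B i)) ⧸ m) := isSimpleModule_iff_isCoatom.mpr hm
  have hψ0 : m.mkQ ≠ 0 := by
    intro h0
    apply hm.1
    rw [← Submodule.ker_mkQ m, h0, LinearMap.ker_zero]
  obtain ⟨j, hj⟩ : ∃ j, m.mkQ.comp (LinearMap.single (DiffOp δ) (fun i => Cyc (B i)) j) ≠ 0 := by
    by_contra! h
    refine hψ0 (LinearMap.pi_ext' fun i => ?_)
    rw [h i, LinearMap.zero_comp]
  let E := LinearEquiv.ofBijective _ (LinearMap.bijective_of_ne_zero hj)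
  let ψ : (∀ i, Cyc (B i)) →ₗ[DiffOp δ] Cyc (B j) := E.symm.toLinearMap.comp m.mkQ
  let ψi := fun i => ψ.comp (LinearMap.single (DiffOp δ) (fun i => Cyc (B i)) i)
  have hψw : ∑ i, ψi i (w i) = 0 := by
    have h1 : ψ w = 0 := by
      have : m.mkQ w = 0 := (Submodule.Quotient.mk_eq_zero m).mpr
        (hwm (Submodule.mem_span_singleton_self w))
      simp only [ψ, LinearMap.comp_apply, this, map_zero]
    rw [← h1]
    conv_rhs => rw [← Finset.univ_sum_single w, map_sum]
    rfl
  have hzero : ∀ i, B i ≠ B j → ψi i = 0 := by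
    intro i hij
    by_contra h0
    exact hij (hiso i j ⟨LinearEquiv.ofBijective _ (LinearMap.bijective_of_ne_zero h0)⟩)
  choose c hc using fun i : {i // B i = B j} =>
    hEnd j ((ψi i).comp (castCyc i.2).symm.toLinearMap)
  have hcw : ∀ i : {i // B i = B j}, c i • castCyc i.2 (w i) = ψi i (w i) := fun i => by
    have := LinearMap.congr_fun (hc i) (castCyc i.2 (w i))
    rw [LinearMap.comp_apply, LinearEquiv.coe_coe, LinearEquiv.symm_apply_apply] at this
    exact this.symm
  have hsum : ∑ i : {i // B i = B j}, c i • castCyc i.2 (w i) = 0 := by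
    simp only [hcw]
    rw [← Finset.sum_subtype (Finset.univ.filter fun i => B i = B j) (by simp)
      (fun i => ψi i (w i)), Finset.sum_filter_of_ne, hψw]
    intro i _ hi
    by_contra hij
    exact hi (by rw [hzero i hij, LinearMap.zero_apply])
  have hcj := Fintype.linearIndependent_iff.mp (hw j) c hsum ⟨j, rfl⟩
  have h1 := hc ⟨j, rfl⟩
  rw [hcj] at h1
  apply hj
  refine LinearMap.ext fun x => ?_
  have h2 := LinearMap.congr_fun h1 (castCyc rfl x)
  rw [LinearMap.comp_apply, LinearEquiv.coe_coe, LinearEquiv.symm_apply_apply] at h2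
  have h3 : ψi j x = 0 := h2.trans (zero_smul _ _)
  exact (LinearEquiv.map_eq_zero_iff E.symm).mp h3

end Density

end DiffOp

/-! ### Comparison of a completely reducible operator with its reduction. -/

namespace DiffPlace

open DiffOp

variable {k K : Type*} [Field k] [Field K] [Algebra k K] {δ : Derivation k K K} (pl : DiffPlace δ)

/-- The semisimple cyclic module of a right-hand factor of an operator over the residue field is a
product of simple modules defined over the residue field. -/
theorem exists_pi_equiv {P L : DiffOp δ} [IsSemisimpleModule (DiffOp δ) (Cyc P)] (hL : L ≠ 0)
    (hf : pl.Fixed L) (hPL : IsRightFactor P L) :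
    ∃ (N : ℕ) (B : Fin N → DiffOp δ),
      (∀ i, (B i).Monic ∧ pl.Fixed (B i) ∧ Irreducible (B i)) ∧
      (∀ i j, Nonempty (Cyc (B i) ≃ₗ[DiffOp δ] Cyc (B j)) → B i = B j) ∧
      Nonempty (Cyc P ≃ₗ[DiffOp δ] ∀ i, Cyc (B i)) := by
  obtain ⟨N, S, e, hS⟩ := IsSemisimpleModule.exists_linearEquiv_fin_dfinsupp (DiffOp δ) (Cyc P)
  let e' : Cyc P ≃ₗ[DiffOp δ] ∀ i, S i := e.trans DFinsupp.linearEquivFunOnFintype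
  have hex : ∀ i, ∃ B : DiffOp δ, B.Monic ∧ pl.Fixed B ∧ Irreducible B ∧
      Nonempty (S i ≃ₗ[DiffOp δ] Cyc B) := by
    intro i
    have hLv : L • e' (DiffOp.mk P 1) i = 0 := by
      obtain ⟨M, rfl⟩ := hPL
      rw [← Pi.smul_apply, ← map_smul, mul_smul, self_smul_mk_one, smul_zero, map_zero]
      rfl
    refine pl.exists_cyc_equiv hL hf (v := e' (DiffOp.mk P 1) i) (fun h0 => ?_) hLv
    have h1 : (LinearMap.proj i).comp e'.toLinearMap = 0 := cyc_hom_ext h0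
    have := IsSimpleModule.nontrivial (DiffOp δ) (S i)
    obtain ⟨x, hx⟩ := exists_ne (0 : S i)
    apply hx
    have h2 := LinearMap.congr_fun h1 (e'.symm (Pi.single i x))
    rw [LinearMap.comp_apply, LinearEquiv.coe_coe, e'.apply_symm_apply, LinearMap.proj_apply,
      Pi.single_eq_same] at h2
    exact h2
  choose B₀ hm hfix hirr E using hex
  -- One operator is chosen per isomorphism class, so that isomorphic factors carry equal operators
  -- and the isotypic blocks are the fibres of `B`.
  let s : Setoid (Fin N) :=
    { r := fun i j => Nonempty (S i ≃ₗ[DiffOp δ] S j)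
      iseqv := ⟨fun i => ⟨LinearEquiv.refl _ _⟩, fun ⟨f⟩ => ⟨f.symm⟩, fun ⟨f⟩ ⟨g⟩ => ⟨f.trans g⟩⟩ }
  let rep : Fin N → Fin N := fun i => (Quotient.mk s i).out
  have hrep : ∀ i, Nonempty (S (rep i) ≃ₗ[DiffOp δ] S i) := fun i => Quotient.mk_out (s := s) i
  have hE : ∀ i, Nonempty (S i ≃ₗ[DiffOp δ] Cyc (B₀ (rep i))) := fun i =>
    ⟨(hrep i).some.symm.trans (E (rep i)).some⟩
  refine ⟨N, fun i => B₀ (rep i), fun i => ⟨hm _, hfix _, hirr _⟩, ?_, ?_⟩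
  · rintro i j ⟨f⟩
    have : Quotient.mk s i = Quotient.mk s j :=
      Quotient.sound (s := s) ⟨(hE i).some.trans (f.trans (hE j).some.symm)⟩
    simp only [rep, this]
  · exact ⟨e'.trans (LinearEquiv.piCongrRight fun i => (hE i).some)⟩

/-- A completely reducible operator with coefficients in the valuation ring, dividing an operator
over the residue field, has a cyclic module isomorphic to that of its reduction. -/
theorem nonempty_cyc_red_equiv [IsAlgClosed k] [CharZero K] {t : K} (ht : δ t = 1)
    (htG : (t, t) ∈ pl.graph)
    (hK : ∀ a : K, ∃ p q : (constants δ)[X], Polynomial.aeval t q ≠ 0 ∧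
      a * Polynomial.aeval t q = Polynomial.aeval t p)
    {X : DiffOp pl.deriv} {L : DiffOp δ} (hP : (pl.gen X).Monic) (hP' : (pl.red X).Monic)
    (hord : (pl.red X).ord = (pl.gen X).ord)
    (hred : (pl.gen X).IsCompletelyReducible) (hL : L ≠ 0) (hf : pl.Fixed L)
    (hPL : IsRightFactor (pl.gen X) L) :
    Nonempty (Cyc (pl.red X) ≃ₗ[DiffOp δ] Cyc (pl.gen X)) := by
  have := hred.isSemisimpleModule
  obtain ⟨N, B, hB, hiso, ⟨e⟩⟩ := pl.exists_pi_equiv hL hf hPL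
  set v := e (DiffOp.mk _ 1) with hv
  have hvtop : Submodule.span (DiffOp δ) {v} = ⊤ := by
    rw [eq_top_iff]
    intro x _
    obtain ⟨Y, hY⟩ := Submodule.Quotient.mk_surjective _ (e.symm x)
    rw [Submodule.mem_span_singleton]
    refine ⟨Y, ?_⟩
    rw [hv, ← map_smul, ← mk_eq_smul_mk_one]
    exact (congrArg e hY).trans (e.apply_symm_apply x)
  have hPv : ∀ i, pl.gen X • v i = 0 := fun i => by
    rw [← Pi.smul_apply, hv, ← map_smul, self_smul_mk_one, map_zero]
    rfl
  have hli := linearIndependent_of_span_eq_top (fun i => (hB i).2.2) hvtop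
  -- Each block is recombined separately. C-combinations of the components of v are still killed by
  -- `gen X`, so their residues are killed by `red X`.
  have hex : ∀ b, (∃ j, B j = b) → ∃ w : {i // B i = b} → Cyc b,
      LinearIndependent (constants δ) w ∧ ∀ i, pl.red X • w i = 0 := by
    rintro _ ⟨j, rfl⟩
    obtain ⟨u, w, hu, huw, hw⟩ :=
      exists_reduces_linearIndependent (pl := pl) (hB j).1 ht htG hK (hli (B j))
    refine ⟨w, hw, fun i => (huw i).red_smul_eq_zero (hB j).1 (hB j).2.1 ?_⟩
    refine Submodule.span_induction (p := fun x _ => pl.gen X • x = 0) ?_ (smul_zero _) ?_ ?_ (hu i)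
    · rintro _ ⟨i, rfl⟩
      rw [← map_smul, hPv, map_zero]
    · intro x y _ _ hx hy
      rw [smul_add, hx, hy, add_zero]
    · intro c x _ hx
      rw [Subfield.smul_def, smul_const_smul c.2, hx, smul_zero]
  choose W hW hW0 using hex
  let w : ∀ i, Cyc (B i) := fun i => W (B i) ⟨i, rfl⟩ ⟨i, rfl⟩
  have hcast : ∀ i b (h : B i = b), castCyc h (w i) = W b ⟨i, h⟩ ⟨i, h⟩ := by
    rintro i _ rfl
    exact castCyc_rfl _
  have hwtop : Submodule.span (DiffOp δ) {w} = ⊤ := by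
    refine span_eq_top_of_linearIndependent (fun i => (hB i).2.2) hiso
      (fun i => exists_constants_smul (hB i).1 (hB i).2.1 (hB i).2.2 ht htG hK) fun j => ?_
    simp only [hcast]
    exact hW (B j) ⟨j, rfl⟩
  have hP'w : pl.red X • w = 0 := funext fun i => hW0 _ _ _
  let g : Cyc (pl.red X) →ₗ[DiffOp δ] ∀ i, Cyc (B i) := cycLift w hP'w
  have hsurj : Function.Surjective g := by
    intro x
    obtain ⟨Y, rfl⟩ := Submodule.mem_span_singleton.mp (hwtop ▸ Submodule.mem_top : x ∈ _)
    exact ⟨DiffOp.mk _ Y, rfl⟩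
  have := finite_cyc hP
  have := finite_cyc hP'
  have := Module.Finite.equiv (e.restrictScalars K)
  have hrank : Module.finrank K (Cyc (pl.red X)) = Module.finrank K (∀ i, Cyc (B i)) := by
    rw [← (e.restrictScalars K).finrank_eq, finrank_cyc hP, finrank_cyc hP', hord]
  have hinj : Function.Injective g :=
    (LinearMap.injective_iff_surjective_of_finrank_eq_finrank (f := g.restrictScalars K)
      hrank).mpr hsurj
  exact ⟨(LinearEquiv.ofBijective g ⟨hinj, hsurj⟩).trans e.symm⟩

end DiffPlace

/-! ### The place of K extending the substitution x = c. -/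

section Substitution

variable {k : Type*} [Field k] {m : ℕ} (c : Fin m → k)

/-- The substitution `xᵢ = cᵢ` for the indices `i` in `s`. -/
def substOn (s : Finset (Fin m)) : PolyTX k m →ₐ[k] PolyTX k m :=
  MvPolynomial.aeval fun v : Option (Fin m) =>
    v.elim (MvPolynomial.X none) fun i =>
      if i ∈ s then MvPolynomial.C (c i) else MvPolynomial.X (some i)

theorem substOn_X_none (s : Finset (Fin m)) :
    substOn c s (MvPolynomial.X none) = MvPolynomial.X none := by
  simp [substOn]

theorem substOn_X_some (s : Finset (Fin m)) (i : Fin m) :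
    substOn c s (MvPolynomial.X (some i))
      = if i ∈ s then MvPolynomial.C (c i) else MvPolynomial.X (some i) := by
  simp [substOn]

theorem substOn_C (s : Finset (Fin m)) (a : k) :
    substOn c s (MvPolynomial.C a) = MvPolynomial.C a :=
  MvPolynomial.algHom_C _ a

theorem substOn_empty (p : PolyTX k m) : substOn c ∅ p = p := by
  have : substOn c ∅ = AlgHom.id k (PolyTX k m) := by
    refine MvPolynomial.algHom_ext fun v => ?_
    cases v <;> simp [substOn_X_none, substOn_X_some]
  rw [this, AlgHom.id_apply]

theorem substOn_univ : substOn c Finset.univ = substX c := by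
  simp [substOn, substX]

theorem substOn_substOn (s s' : Finset (Fin m)) (p : PolyTX k m) :
    substOn c s (substOn c s' p) = substOn c (s ∪ s') p := by
  have : (substOn c s).comp (substOn c s') = substOn c (s ∪ s') := by
    refine MvPolynomial.algHom_ext fun v => ?_
    cases v with
    | none => simp only [AlgHom.comp_apply, substOn_X_none]
    | some i =>
      by_cases h : i ∈ s <;> by_cases h' : i ∈ s' <;>
        simp [substOn_X_some, h, h', substOn_C, -MvPolynomial.algHom_C]
  rw [← this, AlgHom.comp_apply]

theorem pderiv_substOn (s : Finset (Fin m)) (p : PolyTX k m) :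
    MvPolynomial.pderiv none (substOn c s p) = substOn c s (MvPolynomial.pderiv none p) := by
  induction p using MvPolynomial.induction_on with
  | C a => simp [substOn_C, -MvPolynomial.algHom_C]
  | add p q hp hq => simp [hp, hq]
  | mul_X p v hp =>
    rw [map_mul, Derivation.leibniz, Derivation.leibniz, hp]
    cases v with
    | none => simp [substOn_X_none]
    | some i =>
      rw [substOn_X_some]
      split_ifs with h <;> simp [substOn_X_some, h, MvPolynomial.pderiv_X]

/-- The polynomial `xⱼ - cⱼ`. -/
def linX (j : Fin m) : PolyTX k m := MvPolynomial.X (some j) - MvPolynomial.C (c j)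

theorem substOn_linX_self (j : Fin m) : substOn c {j} (linX c j) = 0 := by
  simp [linX, substOn_X_some]

theorem substOn_linX {s : Finset (Fin m)} {j : Fin m} (hj : j ∉ s) :
    substOn c s (linX c j) = linX c j := by
  simp [linX, substOn_X_some, hj]

theorem linX_ne_zero (j : Fin m) : linX c j ≠ 0 := by
  intro h
  have := congrArg (MvPolynomial.aeval fun _ : Option (Fin m) => c j + 1) h
  simp [linX] at this

theorem linX_dvd_sub (j : Fin m) (p : PolyTX k m) : linX c j ∣ p - substOn c {j} p := by
  induction p using MvPolynomial.induction_on with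
  | C a => simp [substOn_C, -MvPolynomial.algHom_C]
  | add p q hp hq =>
    rw [map_add, add_sub_add_comm]
    exact dvd_add hp hq
  | mul_X p v hp =>
    have hv : linX c j ∣ MvPolynomial.X v - substOn c {j} (MvPolynomial.X v) := by
      cases v with
      | none => simp [substOn_X_none]
      | some i =>
        rw [substOn_X_some]
        split_ifs with h
        · rw [Finset.mem_singleton.mp h]
          exact dvd_rfl
        · simp
    rw [map_mul]
    have := dvd_add (hp.mul_right (MvPolynomial.X v)) (hv.mul_left (substOn c {j} p))
    convert this using 1
    ring

/-- A polynomial vanishing at xⱼ = cⱼ is divisible by xⱼ − cⱼ, so removing the full power of xⱼ − cⱼ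
leaves a factor that does not vanish there. -/
theorem exists_eq_linX_pow_mul (j : Fin m) {p : PolyTX k m} (hp : p ≠ 0) :
    ∃ (n : ℕ) (q : PolyTX k m), p = linX c j ^ n * q ∧ substOn c {j} q ≠ 0 := by
  have hu : ¬ IsUnit (linX c j) := fun h => by
    have := h.map (substOn c {j})
    rw [substOn_linX_self] at this
    exact not_isUnit_zero this
  obtain ⟨q, hq, hdvd⟩ :=
    (FiniteMultiplicity.of_not_isUnit hu hp).exists_eq_pow_mul_and_not_dvd
  refine ⟨_, q, hq, fun h0 => hdvd ?_⟩
  have := linX_dvd_sub c j q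
  rwa [h0, sub_zero] at this

theorem algebraMap_ratTX_ne_zero {p : PolyTX k m} (hp : p ≠ 0) :
    algebraMap (PolyTX k m) (RatTX k m) p ≠ 0 := fun h =>
  hp (IsFractionRing.injective (PolyTX k m) (RatTX k m) (by rw [h, map_zero]))

theorem exists_ratTX_eq_div (a : RatTX k m) : ∃ p q : PolyTX k m, q ≠ 0 ∧
    a = algebraMap _ (RatTX k m) p / algebraMap _ (RatTX k m) q := by
  obtain ⟨p, q, hq, rfl⟩ := IsFractionRing.div_surjective (A := PolyTX k m) a
  exact ⟨p, q, nonZeroDivisors.ne_zero hq, rfl⟩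

theorem derivT_div (p q : PolyTX k m) (hq : q ≠ 0) :
    derivT k m (algebraMap _ (RatTX k m) p / algebraMap _ (RatTX k m) q)
      = algebraMap _ (RatTX k m) (MvPolynomial.pderiv none p * q - p * MvPolynomial.pderiv none q)
        / algebraMap _ (RatTX k m) q ^ 2 :=
  fracDerivFun_div _ p q hq

theorem derivT_algebraMap (p : PolyTX k m) :
    derivT k m (algebraMap _ (RatTX k m) p)
      = algebraMap _ (RatTX k m) (MvPolynomial.pderiv none p) := by
  have := derivT_div p 1 one_ne_zero
  simpa using this

/-- The graph of the substitution `xⱼ = cⱼ` on the rational functions with a denominator that does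
not vanish identically at `xⱼ = cⱼ`. -/
def stepGraph (j : Fin m) : Subring (RatTX k m × RatTX k m) where
  carrier := {x | ∃ p q : PolyTX k m, substOn c {j} q ≠ 0 ∧
    x.1 = algebraMap _ (RatTX k m) p / algebraMap _ (RatTX k m) q ∧
    x.2 = algebraMap _ (RatTX k m) (substOn c {j} p) / algebraMap _ (RatTX k m) (substOn c {j} q)}
  one_mem' := ⟨1, 1, by simp, by simp, by simp⟩
  zero_mem' := ⟨0, 1, by simp, by simp, by simp⟩
  neg_mem' := by
    rintro ⟨_, _⟩ ⟨p, q, hq, rfl, rfl⟩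
    exact ⟨-p, q, hq, by simp [neg_div], by simp [neg_div]⟩
  mul_mem' := by
    rintro ⟨_, _⟩ ⟨_, _⟩ ⟨p, q, hq, rfl, rfl⟩ ⟨p', q', hq', rfl, rfl⟩
    refine ⟨p * p', q * q', ?_, ?_, ?_⟩
    · rw [map_mul]
      exact mul_ne_zero hq hq'
    · simp [div_mul_div_comm]
    · simp [div_mul_div_comm]
  add_mem' := by
    rintro ⟨_, _⟩ ⟨_, _⟩ ⟨p, q, hq, rfl, rfl⟩ ⟨p', q', hq', rfl, rfl⟩
    have h1 : q ≠ 0 := by rintro rfl; simp at hq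
    have h2 : q' ≠ 0 := by rintro rfl; simp at hq'
    refine ⟨p * q' + q * p', q * q', ?_, ?_, ?_⟩
    · rw [map_mul]
      exact mul_ne_zero hq hq'
    · simp only [Prod.fst_add]
      rw [div_add_div _ _ (algebraMap_ratTX_ne_zero h1) (algebraMap_ratTX_ne_zero h2)]
      simp
    · simp only [Prod.snd_add]
      rw [div_add_div _ _ (algebraMap_ratTX_ne_zero hq) (algebraMap_ratTX_ne_zero hq')]
      simp

/-- A place of `K` that extends the substitution `xᵢ = cᵢ`, `i ∈ s`, in polynomials. -/
structure IsSubstPlace (s : Finset (Fin m)) (G : Subring (RatTX k m × RatTX k m)) : Prop where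
  eq_zero : ∀ {b}, (0, b) ∈ G → b = 0
  mem_or : ∀ {a : RatTX k m}, a ≠ 0 → (∃ b, (a, b) ∈ G) ∨ ∃ b, (a⁻¹, b) ∈ G
  inv_mem : ∀ {a b}, (a, b) ∈ G → b ≠ 0 → (a⁻¹, b⁻¹) ∈ G
  deriv_mem : ∀ {a b}, (a, b) ∈ G → (derivT k m a, derivT k m b) ∈ G
  scale : ∀ {a : RatTX k m}, a ≠ 0 →
    ∃ c, c ≠ 0 ∧ derivT k m c = 0 ∧ ∃ b, b ≠ 0 ∧ (c * a, b) ∈ G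
  poly_mem : ∀ p, (algebraMap _ (RatTX k m) p, algebraMap _ (RatTX k m) (substOn c s p)) ∈ G
  exists_eq : ∀ {a b}, (a, b) ∈ G → ∃ p q : PolyTX k m, q ≠ 0 ∧ substOn c s p = p ∧
    substOn c s q = q ∧ b = algebraMap _ (RatTX k m) p / algebraMap _ (RatTX k m) q

/-- Every nonzero rational function is a power of `xⱼ - cⱼ` times a unit. -/
theorem exists_linX_decomposition (j : Fin m) {a : RatTX k m} (ha : a ≠ 0) :
    ∃ (n n' : ℕ) (u v : RatTX k m), v ≠ 0 ∧ (u, v) ∈ stepGraph c j ∧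
      (u⁻¹, v⁻¹) ∈ stepGraph c j ∧
      a = algebraMap _ (RatTX k m) (linX c j) ^ n * u / algebraMap _ (RatTX k m) (linX c j) ^ n' := by
  obtain ⟨p, q, hq, rfl⟩ := exists_ratTX_eq_div a
  have hp : p ≠ 0 := by rintro rfl; simp at ha
  obtain ⟨n, p', rfl, hp'⟩ := exists_eq_linX_pow_mul c j hp
  obtain ⟨n', q', rfl, hq'⟩ := exists_eq_linX_pow_mul c j hq
  refine ⟨n, n', algebraMap _ _ p' / algebraMap _ _ q',
    algebraMap _ _ (substOn c {j} p') / algebraMap _ _ (substOn c {j} q'), ?_,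
    ⟨p', q', hq', rfl, rfl⟩, ⟨q', p', hp', inv_div _ _, inv_div _ _⟩, ?_⟩
  · exact div_ne_zero (algebraMap_ratTX_ne_zero hp') (algebraMap_ratTX_ne_zero hq')
  · simp only [map_mul, map_pow]
    rw [mul_div_assoc', div_div, mul_comm (algebraMap _ _ q')]

theorem stepGraph_poly_mem (j : Fin m) (p : PolyTX k m) :
    (algebraMap _ (RatTX k m) p, algebraMap _ (RatTX k m) (substOn c {j} p)) ∈ stepGraph c j :=
  ⟨p, 1, by simp, by simp, by simp⟩

/-- The sign of the (xⱼ − cⱼ)-adic order decides which of a and a⁻¹ is integral. -/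
theorem stepGraph_mem_or (j : Fin m) {a : RatTX k m} (ha : a ≠ 0) :
    (∃ b, (a, b) ∈ stepGraph c j) ∨ ∃ b, (a⁻¹, b) ∈ stepGraph c j := by
  obtain ⟨n, n', u, v, -, huv, huv', rfl⟩ := exists_linX_decomposition c j ha
  have hy : algebraMap _ (RatTX k m) (linX c j) ≠ 0 := algebraMap_ratTX_ne_zero (linX_ne_zero c j)
  set y := algebraMap _ (RatTX k m) (linX c j)
  have hpow : ∀ n, (y ^ n, algebraMap _ (RatTX k m) (substOn c {j} (linX c j)) ^ n) ∈
      stepGraph c j := fun n => (stepGraph c j).pow_mem (stepGraph_poly_mem c j (linX c j)) n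
  rcases le_total n' n with h | h
  · left
    rw [show y ^ n * u / y ^ n' = y ^ (n - n') * u by rw [pow_sub₀ _ hy h]; ring]
    exact ⟨_, (stepGraph c j).mul_mem (hpow (n - n')) huv⟩
  · right
    rw [show (y ^ n * u / y ^ n')⁻¹ = y ^ (n' - n) * u⁻¹ by
      rw [pow_sub₀ _ hy h, inv_div, div_eq_mul_inv, mul_inv]; ring]
    exact ⟨_, (stepGraph c j).mul_mem (hpow (n' - n)) huv'⟩

theorem isSubstPlace_bot : IsSubstPlace c ∅
    ((RingHom.id (RatTX k m)).prod (RingHom.id (RatTX k m))).range := by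
  have hmem : ∀ {a b : RatTX k m},
      (a, b) ∈ ((RingHom.id (RatTX k m)).prod (RingHom.id (RatTX k m))).range ↔ a = b := by
    intro a b
    constructor
    · rintro ⟨x, hx⟩
      exact (congrArg Prod.fst hx).symm.trans (congrArg Prod.snd hx)
    · rintro rfl
      exact ⟨a, rfl⟩
  refine ⟨?_, ?_, ?_, ?_, ?_, ?_, ?_⟩
  · intro b h
    exact (hmem.mp h).symm
  · intro a _
    exact .inl ⟨a, hmem.mpr rfl⟩
  · intro a b h _
    exact hmem.mpr (by rw [hmem.mp h])
  · intro a b h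
    exact hmem.mpr (by rw [hmem.mp h])
  · intro a ha
    exact ⟨1, one_ne_zero, by simp, a, ha, hmem.mpr (one_mul a)⟩
  · intro p
    exact hmem.mpr (by rw [substOn_empty])
  · intro a b _
    obtain ⟨p, q, hq, rfl⟩ := exists_ratTX_eq_div b
    exact ⟨p, q, hq, substOn_empty c p, substOn_empty c q, rfl⟩

/-- The composition of a graph with the substitution `xⱼ = cⱼ`. -/
def compStep (j : Fin m) (G : Subring (RatTX k m × RatTX k m)) :
    Subring (RatTX k m × RatTX k m) where
  carrier := {x | ∃ b, (x.1, b) ∈ G ∧ (b, x.2) ∈ stepGraph c j}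
  one_mem' := ⟨1, G.one_mem, (stepGraph c j).one_mem⟩
  zero_mem' := ⟨0, G.zero_mem, (stepGraph c j).zero_mem⟩
  neg_mem' := fun ⟨b, h, h'⟩ => ⟨-b, G.neg_mem h, (stepGraph c j).neg_mem h'⟩
  mul_mem' := fun ⟨b, h, h'⟩ ⟨d, g, g'⟩ => ⟨b * d, G.mul_mem h g, (stepGraph c j).mul_mem h' g'⟩
  add_mem' := fun ⟨b, h, h'⟩ ⟨d, g, g'⟩ => ⟨b + d, G.add_mem h g, (stepGraph c j).add_mem h' g'⟩

theorem substOn_ne_zero_imp {s : Finset (Fin m)} {p : PolyTX k m} (h : substOn c s p ≠ 0) :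
    p ≠ 0 := by
  rintro rfl
  simp at h

theorem stepGraph_eq_zero {j : Fin m} {b : RatTX k m} (h : (0, b) ∈ stepGraph c j) : b = 0 := by
  obtain ⟨p, q, hq, h0, rfl⟩ := h
  have hp : p = 0 := by
    by_contra hp
    exact div_ne_zero (algebraMap_ratTX_ne_zero hp)
      (algebraMap_ratTX_ne_zero (substOn_ne_zero_imp c hq)) h0.symm
  simp [hp]

theorem stepGraph_inv_mem {j : Fin m} {a b : RatTX k m} (h : (a, b) ∈ stepGraph c j)
    (hb : b ≠ 0) : (a⁻¹, b⁻¹) ∈ stepGraph c j := by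
  obtain ⟨p, q, hq, ha, rfl⟩ := h
  dsimp only at ha hb ⊢
  rw [ha]
  refine ⟨q, p, fun h0 => hb ?_, inv_div _ _, inv_div _ _⟩
  rw [h0, map_zero, zero_div]

theorem stepGraph_deriv_mem {j : Fin m} {a b : RatTX k m} (h : (a, b) ∈ stepGraph c j) :
    (derivT k m a, derivT k m b) ∈ stepGraph c j := by
  obtain ⟨p, q, hq, ha, hb⟩ := h
  dsimp only at ha hb
  rw [ha, hb, derivT_div _ _ (substOn_ne_zero_imp c hq), derivT_div _ _ hq]
  refine ⟨MvPolynomial.pderiv none p * q - p * MvPolynomial.pderiv none q, q ^ 2, ?_,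
    by rw [map_pow], ?_⟩
  · rw [map_pow]
    exact pow_ne_zero _ hq
  · simp only [map_sub, map_mul, map_pow, pderiv_substOn]

/-- Fractions of polynomials fixed by a substitution reduce to fractions of fixed polynomials. -/
theorem stepGraph_exists_eq {j : Fin m} {s : Finset (Fin m)} (hj : j ∉ s) {p q : PolyTX k m}
    (hq : q ≠ 0) (hps : substOn c s p = p) (hqs : substOn c s q = q) {b : RatTX k m}
    (h : (algebraMap _ (RatTX k m) p / algebraMap _ (RatTX k m) q, b) ∈ stepGraph c j) :
    ∃ p q : PolyTX k m, q ≠ 0 ∧ substOn c (insert j s) p = p ∧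
    substOn c (insert j s) q = q ∧ b = algebraMap _ (RatTX k m) p / algebraMap _ (RatTX k m) q := by
  by_cases hb : b = 0
  · exact ⟨0, 1, one_ne_zero, by simp, by simp, by simp [hb]⟩
  obtain ⟨p', q', hq', he, hb'⟩ := h
  dsimp only at he hb'
  have hp' : substOn c {j} p' ≠ 0 := fun h0 => hb (by rw [hb', h0, map_zero, zero_div])
  have hp'0 := substOn_ne_zero_imp c hp'
  have hq'0 := substOn_ne_zero_imp c hq'
  rw [div_eq_div_iff (algebraMap_ratTX_ne_zero hq) (algebraMap_ratTX_ne_zero hq'0), ← map_mul,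
    ← map_mul] at he
  replace he : p * q' = p' * q := IsFractionRing.injective (PolyTX k m) (RatTX k m) he
  have hp : p ≠ 0 := by
    rintro rfl
    rw [zero_mul] at he
    exact mul_ne_zero hp'0 hq he.symm
  obtain ⟨n, p₁, rfl, hp₁⟩ := exists_eq_linX_pow_mul c j hp
  obtain ⟨n', q₁, rfl, hq₁⟩ := exists_eq_linX_pow_mul c j hq
  have hy := linX_ne_zero c j
  have hfix : ∀ (n : ℕ) (p : PolyTX k m), substOn c s (linX c j ^ n * p) = linX c j ^ n * p →
      substOn c (insert j s) (substOn c {j} p) = substOn c {j} p := by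
    intro n p h
    rw [map_mul, map_pow, substOn_linX c hj] at h
    have h1 : substOn c s p = p := mul_left_cancel₀ (pow_ne_zero n hy) h
    rw [Finset.insert_eq, ← substOn_substOn, substOn_substOn c s, Finset.union_comm,
      ← substOn_substOn c {j} s, h1, substOn_substOn, Finset.union_self]
  refine ⟨substOn c {j} p₁, substOn c {j} q₁, hq₁, hfix n p₁ hps, hfix n' q₁ hqs, ?_⟩
  -- Since the residue is nonzero, none of p₁, q₁, p', q' vanishes at xⱼ = cⱼ; unequal powers of xⱼ
  -- − cⱼ in p and q would contradict this.
  have key : p₁ * q' = p' * q₁ := by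
    rcases lt_trichotomy n n' with h | rfl | h
    · exfalso
      obtain ⟨d, rfl⟩ := Nat.exists_eq_add_of_lt h
      have h1 : p₁ * q' = linX c j * (linX c j ^ d * p' * q₁) := by
        refine mul_left_cancel₀ (pow_ne_zero n hy) ?_
        linear_combination he
      have h2 := congrArg (substOn c {j}) h1
      rw [map_mul, map_mul (substOn c {j}) (linX c j), substOn_linX_self, zero_mul] at h2
      exact mul_ne_zero hp₁ hq' h2
    · refine mul_left_cancel₀ (pow_ne_zero n hy) ?_
      linear_combination he
    · exfalso
      obtain ⟨d, rfl⟩ := Nat.exists_eq_add_of_lt h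
      have h1 : p' * q₁ = linX c j * (linX c j ^ d * p₁ * q') := by
        refine mul_left_cancel₀ (pow_ne_zero n' hy) ?_
        linear_combination -he
      have h2 := congrArg (substOn c {j}) h1
      rw [map_mul, map_mul (substOn c {j}) (linX c j), substOn_linX_self, zero_mul] at h2
      exact mul_ne_zero hp' hq₁ h2
  rw [hb', div_eq_div_iff (algebraMap_ratTX_ne_zero hq') (algebraMap_ratTX_ne_zero hq₁),
    ← map_mul, ← map_mul, ← map_mul, ← map_mul, ← key, map_mul, map_mul]

theorem derivT_linX (j : Fin m) : derivT k m (algebraMap _ (RatTX k m) (linX c j)) = 0 := by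
  rw [derivT_algebraMap]
  simp [linX, MvPolynomial.pderiv_X]

/-- Composing places gives a place. Variables are substituted one at a time because, for m > 1, the
rational functions regular at x = c do not form a valuation ring. -/
theorem IsSubstPlace.compStep {s : Finset (Fin m)} {G : Subring (RatTX k m × RatTX k m)}
    (hG : IsSubstPlace c s G) {j : Fin m} (hj : j ∉ s) :
    IsSubstPlace c (insert j s) (compStep c j G) := by
  refine ⟨?_, ?_, ?_, ?_, ?_, ?_, ?_⟩
  · rintro b ⟨d, h, h'⟩
    rw [hG.eq_zero h] at h'
    exact stepGraph_eq_zero c h'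
  · have key : ∀ {a b : RatTX k m}, (a, b) ∈ G →
        (∃ d, (a, d) ∈ _root_.compStep c j G) ∨ ∃ d, (a⁻¹, d) ∈ _root_.compStep c j G := by
      intro a b h
      by_cases hb : b = 0
      · exact .inl ⟨0, b, h, show (b, 0) ∈ stepGraph c j by rw [hb]; exact (stepGraph c j).zero_mem⟩
      rcases stepGraph_mem_or c j hb with ⟨d, h'⟩ | ⟨d, h'⟩
      · exact .inl ⟨d, b, h, h'⟩
      · exact .inr ⟨d, b⁻¹, hG.inv_mem h hb, h'⟩
    intro a ha
    rcases hG.mem_or ha with ⟨b, h⟩ | ⟨b, h⟩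
    · exact key h
    · have := (key h).symm
      rwa [inv_inv] at this
  · rintro a b ⟨d, h, h'⟩ hb
    have hd : d ≠ 0 := by
      rintro rfl
      exact hb (stepGraph_eq_zero c h')
    exact ⟨d⁻¹, hG.inv_mem h hd, stepGraph_inv_mem c h' hb⟩
  · rintro a b ⟨d, h, h'⟩
    exact ⟨_, hG.deriv_mem h, stepGraph_deriv_mem c h'⟩
  · intro a ha
    obtain ⟨e, he0, he, b, hb, heb⟩ := hG.scale ha
    -- The residue b is made a unit for the next step by powers of y = xⱼ − cⱼ. This y is a constant
    -- and, since j ∉ s, its own residue in G, so the same factor can be applied to a.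
    obtain ⟨n, n', u, v, hv, huv, -, rfl⟩ := exists_linX_decomposition c j hb
    set y := algebraMap _ (RatTX k m) (linX c j) with hydef
    have hy0 : y ≠ 0 := algebraMap_ratTX_ne_zero (linX_ne_zero c j)
    have hy : (y, y) ∈ G := by
      have := hG.poly_mem (linX c j)
      rwa [substOn_linX c hj] at this
    have hdy : derivT k m y = 0 := derivT_linX c j
    have hmem : (y ^ n' * (y⁻¹) ^ n, y ^ n' * (y⁻¹) ^ n) ∈ G :=
      G.mul_mem (G.pow_mem hy n') (G.pow_mem (hG.inv_mem hy hy0) n)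
    refine ⟨y ^ n' * (y⁻¹) ^ n * e,
      mul_ne_zero (mul_ne_zero (pow_ne_zero _ hy0) (pow_ne_zero _ (inv_ne_zero hy0))) he0, ?_,
      v, hv, u, ?_, huv⟩
    · have h1 : y ∈ constants (derivT k m) := hdy
      exact mul_mem (mul_mem (pow_mem h1 _) (pow_mem ((constants _).inv_mem h1) _)) he
    · have h1 := G.mul_mem hmem heb
      rwa [Prod.mk_mul_mk, ← mul_assoc, show y ^ n' * y⁻¹ ^ n * (y ^ n * u / y ^ n') = u by
        rw [inv_pow]; field_simp] at h1
  · intro p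
    refine ⟨_, hG.poly_mem p, ?_⟩
    have := stepGraph_poly_mem c j (substOn c s p)
    rwa [substOn_substOn, ← Finset.insert_eq] at this
  · rintro a b ⟨d, h, h'⟩
    obtain ⟨p, q, hq, hp, hq', rfl⟩ := hG.exists_eq h
    exact stepGraph_exists_eq c hj hq hp hq' h'

theorem exists_isSubstPlace (s : Finset (Fin m)) : ∃ G, IsSubstPlace c s G := by
  induction s using Finset.induction_on with
  | empty => exact ⟨_, isSubstPlace_bot c⟩
  | insert j s hj ih =>
    obtain ⟨G, hG⟩ := ih
    exact ⟨_, hG.compStep c hj⟩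

/-! ### Constants of K and of k(t), and agreement of the place with rational substitution. -/

theorem derivT_varT : derivT k m (varT k m) = 1 := by
  rw [varT, derivT_algebraMap]
  simp

theorem algebraMap_mem_constants (x : k) : algebraMap k (RatTX k m) x ∈ constants (derivT k m) :=
  (derivT k m).map_algebraMap x

/-- The xᵢ are constants for ∂_t and are absorbed into the coefficients; passing to fractions gives
K = C(t). -/
theorem exists_aeval_varT_constants (p : PolyTX k m) : ∃ q : (constants (derivT k m))[X],
    Polynomial.aeval (varT k m) q = algebraMap _ (RatTX k m) p := by
  induction p using MvPolynomial.induction_on with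
  | C a => exact ⟨Polynomial.C ⟨_, algebraMap_mem_constants a⟩, by
      rw [Polynomial.aeval_C, ← MvPolynomial.algebraMap_eq,
        ← IsScalarTower.algebraMap_apply]
      rfl⟩
  | add p q hp hq =>
    obtain ⟨p', hp⟩ := hp
    obtain ⟨q', hq⟩ := hq
    exact ⟨p' + q', by rw [map_add, map_add, hp, hq]⟩
  | mul_X p v hp =>
    obtain ⟨p', hp⟩ := hp
    cases v with
    | none => exact ⟨p' * Polynomial.X, by rw [map_mul, map_mul, hp, Polynomial.aeval_X]; rfl⟩
    | some i =>
      have hx : derivT k m (varX k i) = 0 := by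
        rw [varX, derivT_algebraMap]
        simp [MvPolynomial.pderiv_X]
      exact ⟨p' * Polynomial.C ⟨_, hx⟩, by rw [map_mul, map_mul, hp, Polynomial.aeval_C]; rfl⟩

theorem exists_fraction_varT_constants (a : RatTX k m) :
    ∃ p q : (constants (derivT k m))[X], Polynomial.aeval (varT k m) q ≠ 0 ∧
      a * Polynomial.aeval (varT k m) q = Polynomial.aeval (varT k m) p := by
  obtain ⟨p, q, hq, rfl⟩ := exists_ratTX_eq_div a
  obtain ⟨p', hp'⟩ := exists_aeval_varT_constants p
  obtain ⟨q', hq'⟩ := exists_aeval_varT_constants q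
  have h := algebraMap_ratTX_ne_zero hq
  exact ⟨p', q', by rwa [hq'], by rw [hp', hq', div_mul_cancel₀ _ h]⟩

theorem exists_aeval_varT_substX (p : PolyTX k m) : ∃ q : k[X],
    Polynomial.aeval (varT k m) q = algebraMap _ (RatTX k m) (substX c p) := by
  rw [← substOn_univ]
  induction p using MvPolynomial.induction_on with
  | C a => exact ⟨Polynomial.C a, by
      rw [Polynomial.aeval_C, substOn_C, ← MvPolynomial.algebraMap_eq,
        ← IsScalarTower.algebraMap_apply]⟩
  | add p q hp hq =>
    obtain ⟨p', hp⟩ := hp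
    obtain ⟨q', hq⟩ := hq
    exact ⟨p' + q', by rw [map_add, map_add, map_add, hp, hq]⟩
  | mul_X p v hp =>
    obtain ⟨p', hp⟩ := hp
    cases v with
    | none => exact ⟨p' * Polynomial.X, by
        rw [map_mul, map_mul, map_mul, hp, Polynomial.aeval_X, substOn_X_none]; rfl⟩
    | some i => exact ⟨p' * Polynomial.C (c i), by
        rw [map_mul, map_mul, map_mul, hp, Polynomial.aeval_C, substOn_X_some,
          if_pos (Finset.mem_univ i), ← MvPolynomial.algebraMap_eq,
          ← IsScalarTower.algebraMap_apply]⟩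

instance [CharZero k] : CharZero (RatTX k m) :=
  charZero_of_injective_algebraMap (algebraMap k (RatTX k m)).injective

/-- The constants of `k(t)` are the elements of `k`. -/
theorem exists_eq_algebraMap_of_deriv_eq_zero [CharZero k] {p q : k[X]} {b : RatTX k m}
    (hq : Polynomial.aeval (varT k m) q ≠ 0)
    (hb : b * Polynomial.aeval (varT k m) q = Polynomial.aeval (varT k m) p)
    (hd : derivT k m b = 0) : ∃ x : k, b = algebraMap k (RatTX k m) x := by
  let φ : k →+* constants (derivT k m) :=
    (algebraMap k (RatTX k m)).codRestrict _ algebraMap_mem_constants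
  have hφ : ∀ p : k[X], Polynomial.aeval (varT k m) (p.map φ) = Polynomial.aeval (varT k m) p := by
    intro p
    rw [Polynomial.aeval_def, Polynomial.eval₂_map]
    rfl
  -- For constant b, the equation b q(t) = p(t) is a polynomial relation for t over the constants,
  -- so it holds coefficientwise and b is a quotient of coefficients in k.
  have h0 : p.map φ - Polynomial.C (⟨b, hd⟩ : constants (derivT k m)) * q.map φ = 0 := by
    refine eq_zero_of_aeval_eq_zero derivT_varT ?_
    rw [map_sub, map_mul, hφ, hφ, Polynomial.aeval_C, ← hb]
    exact sub_self _
  obtain ⟨i, hi⟩ : ∃ i, q.coeff i ≠ 0 := by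
    by_contra! h
    exact hq (by rw [show q = 0 from Polynomial.ext h, map_zero])
  have h1 := congrArg (fun p => ((p.coeff i : constants (derivT k m)) : RatTX k m)) h0
  simp only [Polynomial.coeff_sub, Polynomial.coeff_C_mul, Polynomial.coeff_map,
    Polynomial.coeff_zero] at h1
  have h2 : algebraMap k (RatTX k m) (p.coeff i) - b * algebraMap k (RatTX k m) (q.coeff i) = 0 := h1
  refine ⟨p.coeff i / q.coeff i, ?_⟩
  rw [map_div₀, eq_div_iff ((map_ne_zero _).mpr hi)]
  exact (sub_eq_zero.mp h2).symm

variable {c} in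
/-- The place of `K` defined by a graph extending the substitution `x = c`. -/
def IsSubstPlace.place [CharZero k] {G : Subring (RatTX k m × RatTX k m)}
    (hG : IsSubstPlace c Finset.univ G) : DiffPlace (derivT k m) where
  graph := G
  eq_zero := hG.eq_zero
  mem_or := hG.mem_or
  inv_mem := hG.inv_mem
  deriv_mem := hG.deriv_mem
  idem := by
    intro a b h
    obtain ⟨p, q, hq, hp', hq', rfl⟩ := hG.exists_eq h
    have h1 := hG.poly_mem p
    have h2 := hG.poly_mem q
    rw [hp'] at h1
    rw [hq'] at h2
    rw [div_eq_mul_inv]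
    exact G.mul_mem h1 (hG.inv_mem h2 (algebraMap_ratTX_ne_zero hq))
  scale := hG.scale
  const_mem := by
    intro a b h ha
    have hd := hG.deriv_mem h
    rw [ha] at hd
    obtain ⟨p, q, hq, hp', hq', rfl⟩ := hG.exists_eq h
    obtain ⟨p₁, hp₁⟩ := exists_aeval_varT_substX c p
    obtain ⟨q₁, hq₁⟩ := exists_aeval_varT_substX c q
    rw [← substOn_univ, hp'] at hp₁
    rw [← substOn_univ, hq'] at hq₁
    have h0 := algebraMap_ratTX_ne_zero hq
    exact exists_eq_algebraMap_of_deriv_eq_zero (p := p₁) (q := q₁) (by rwa [hq₁])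
      (by rw [hp₁, hq₁, div_mul_cancel₀ _ h0]) (hG.eq_zero hd)

/-- The elements of `k(t)` are fractions of polynomials fixed by the substitution. -/
theorem exists_eq_div_of_mem_fieldT {a : RatTX k m} (ha : a ∈ fieldT k m) :
    ∃ p q : PolyTX k m, q ≠ 0 ∧ substX c p = p ∧ substX c q = q ∧
      a = algebraMap _ (RatTX k m) p / algebraMap _ (RatTX k m) q := by
  have hX : substX c (MvPolynomial.X none) = MvPolynomial.X none := by
    rw [← substOn_univ, substOn_X_none]
  refine IntermediateField.adjoin_induction (F := k) (s := {varT k m}) (p := fun a _ =>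
    ∃ p q : PolyTX k m, q ≠ 0 ∧ substX c p = p ∧ substX c q = q ∧
      a = algebraMap _ (RatTX k m) p / algebraMap _ (RatTX k m) q) ?_ ?_ ?_ ?_ ?_ ha
  · rintro _ rfl
    exact ⟨MvPolynomial.X none, 1, one_ne_zero, hX, map_one _, by simp [varT]⟩
  · intro x
    refine ⟨MvPolynomial.C x, 1, one_ne_zero, MvPolynomial.algHom_C _ x, map_one _, ?_⟩
    rw [map_one, div_one, ← MvPolynomial.algebraMap_eq, ← IsScalarTower.algebraMap_apply]
  · rintro _ _ _ _ ⟨p, q, hq, hp', hq', rfl⟩ ⟨p₁, q₁, hq₁, hp₁', hq₁', rfl⟩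
    refine ⟨p * q₁ + q * p₁, q * q₁, mul_ne_zero hq hq₁, by simp only [map_add, map_mul, *],
      by simp only [map_mul, *], ?_⟩
    rw [div_add_div _ _ (algebraMap_ratTX_ne_zero hq) (algebraMap_ratTX_ne_zero hq₁)]
    simp
  · rintro _ _ ⟨p, q, hq, hp', hq', rfl⟩
    by_cases hp : p = 0
    · exact ⟨0, 1, one_ne_zero, map_zero _, map_one _, by simp [hp]⟩
    · exact ⟨q, p, hp, hq', hp', inv_div _ _⟩
  · rintro _ _ _ _ ⟨p, q, hq, hp', hq', rfl⟩ ⟨p₁, q₁, hq₁, hp₁', hq₁', rfl⟩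
    refine ⟨p * p₁, q * q₁, mul_ne_zero hq hq₁, by simp only [map_mul, *],
      by simp only [map_mul, *], ?_⟩
    rw [div_mul_div_comm]
    simp

/-- The elements of `k(t)[x, 1/r]` have denominators that do not vanish identically at `x = c`. -/
theorem exists_eq_div_of_mem_localRing {r : PolyTX k m} (hr : substX c r ≠ 0) {a : RatTX k m}
    (ha : a ∈ localRing r) : ∃ p q : PolyTX k m, substX c q ≠ 0 ∧
      a = algebraMap _ (RatTX k m) p / algebraMap _ (RatTX k m) q := by
  have hne : ∀ {q : PolyTX k m}, substX c q ≠ 0 → q ≠ 0 := by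
    rintro _ h rfl
    simp at h
  refine Algebra.adjoin_induction (p := fun a _ => ∃ p q : PolyTX k m, substX c q ≠ 0 ∧
      a = algebraMap _ (RatTX k m) p / algebraMap _ (RatTX k m) q) ?_ ?_ ?_ ?_ ha
  · rintro _ (⟨i, rfl⟩ | rfl)
    · exact ⟨MvPolynomial.X (some i), 1, by simp, by simp [varX]⟩
    · exact ⟨1, r, hr, by simp⟩
  · rintro ⟨x, hx⟩
    obtain ⟨p, q, hq, -, hq', h⟩ := exists_eq_div_of_mem_fieldT c hx
    exact ⟨p, q, by rwa [hq'], h⟩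
  · rintro _ _ _ _ ⟨p, q, hq, rfl⟩ ⟨p₁, q₁, hq₁, rfl⟩
    refine ⟨p * q₁ + q * p₁, q * q₁, by rw [map_mul]; exact mul_ne_zero hq hq₁, ?_⟩
    rw [div_add_div _ _ (algebraMap_ratTX_ne_zero (hne hq)) (algebraMap_ratTX_ne_zero (hne hq₁))]
    simp
  · rintro _ _ _ _ ⟨p, q, hq, rfl⟩ ⟨p₁, q₁, hq₁, rfl⟩
    refine ⟨p * p₁, q * q₁, by rw [map_mul]; exact mul_ne_zero hq hq₁, ?_⟩
    rw [div_mul_div_comm]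
    simp

/-- A place extending the substitution agrees with the substitution in rational functions. -/
theorem IsSubstPlace.ratSubstX_mem {G : Subring (RatTX k m × RatTX k m)}
    (hG : IsSubstPlace c Finset.univ G) {r : PolyTX k m} (hr : substX c r ≠ 0) {a : RatTX k m}
    (ha : a ∈ localRing r) : (a, ratSubstX c a) ∈ G := by
  obtain ⟨p, q, hq, h⟩ := exists_eq_div_of_mem_localRing c hr ha
  have hq0 : q ≠ 0 := by
    rintro rfl
    simp at hq
  set n := IsFractionRing.num (PolyTX k m) a with hn
  set d := (IsFractionRing.den (PolyTX k m) a : PolyTX k m) with hd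
  have hd0 : d ≠ 0 := nonZeroDivisors.ne_zero (IsFractionRing.den (PolyTX k m) a).2
  have had : a = algebraMap _ (RatTX k m) n / algebraMap _ (RatTX k m) d := by
    rw [← IsFractionRing.mk'_num_den (PolyTX k m) a, IsFractionRing.mk'_eq_div]
  -- The denominator in lowest terms divides every other one, so it does not vanish at x = c either.
  have hdvd : d ∣ q := by
    rw [had, div_eq_div_iff (algebraMap_ratTX_ne_zero hd0) (algebraMap_ratTX_ne_zero hq0),
      ← map_mul, ← map_mul] at h
    have h1 : n * q = p * d := IsFractionRing.injective (PolyTX k m) (RatTX k m) h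
    exact (IsFractionRing.num_den_reduced (PolyTX k m) a).symm.dvd_of_dvd_mul_left
      ⟨p, by rw [h1, mul_comm]⟩
  have hds : substX c d ≠ 0 := by
    obtain ⟨x, rfl⟩ := hdvd
    rw [map_mul] at hq
    exact left_ne_zero_of_mul hq
  have h1 := hG.poly_mem n
  have h2 := hG.inv_mem (hG.poly_mem d) (by
    rw [substOn_univ]
    exact algebraMap_ratTX_ne_zero hds)
  have h3 := G.mul_mem h1 h2
  rw [Prod.mk_mul_mk, ← div_eq_mul_inv, ← div_eq_mul_inv, ← had, substOn_univ] at h3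
  exact h3

theorem ratSubstX_zero : ratSubstX c (0 : RatTX k m) = 0 := by
  have : IsFractionRing.num (PolyTX k m) (0 : RatTX k m) = 0 := IsFractionRing.num_zero
  rw [ratSubstX, this, map_zero, map_zero, zero_div]

theorem DiffOp.coeff_specialize (P : DiffOp (derivT k m)) (i : ℕ) :
    (P.specialize c).coeff i = ratSubstX c (P.coeff i) := by
  rw [specialize, coeff_ofPoly, Polynomial.sum_def, Polynomial.finsetSum_coeff]
  simp only [Polynomial.coeff_monomial, Finset.sum_ite_eq', Polynomial.mem_support_iff]
  split_ifs with h
  · rfl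
  · rw [show P.coeff i = 0 from Polynomial.notMem_support_iff.mp h, ratSubstX_zero]

end Substitution

/-! ### Similarity of the operator and its specialization. -/

theorem mainTheorem5 {k : Type*} [Field k] [IsAlgClosed k] [CharZero k] (m : ℕ)
    (P : DiffOp (derivT k m)) (r : PolyTX k m)
    (hmonic : P.Monic) (hsep : P.IsSeparableXT) (hred : P.IsCompletelyReducible)
    (hcoeff : ∀ i, P.coeff i ∈ localRing r)
    (c : Fin m → k) (hc : substX c r ≠ 0) :
    (P.specialize c).IsSimilarTo P ∧ P.IsSimilarTo (P.specialize c) := by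
  obtain ⟨G, hG⟩ := exists_isSubstPlace c Finset.univ
  obtain ⟨-, L, hL, hLt, hPL⟩ := hsep
  obtain ⟨X, hX, hXr⟩ := hG.place.exists_lift (P := P) (b := fun i => ratSubstX c (P.coeff i))
    fun i => hG.ratSubstX_mem c hc (hcoeff i)
  have hXs : hG.place.red X = P.specialize c :=
    DiffOp.ext_coeff fun i => by rw [hXr, DiffOp.coeff_specialize]
  -- Elements of k(t) are fractions of polynomials unchanged by x = c, hence their own residues.
  have hf : hG.place.Fixed L := fun i => by
    obtain ⟨p, q, hq, hp', hq', h⟩ := exists_eq_div_of_mem_fieldT c (hLt i)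
    have h1 := hG.poly_mem p
    have h2 := hG.poly_mem q
    rw [substOn_univ, hp'] at h1
    rw [substOn_univ, hq'] at h2
    rw [h, div_eq_mul_inv]
    exact G.mul_mem h1 (hG.inv_mem h2 (algebraMap_ratTX_ne_zero hq))
  -- The leading coefficient 1 has residue 1, so specialization preserves the order.
  have hlead : (P.specialize c).coeff P.ord = 1 := by
    have h1 := hG.place.coeff_mem X P.ord
    rw [hX, hXs, DiffOp.monic_iff.mp hmonic] at h1
    exact hG.place.unique h1 hG.place.one_mem
  have hord : (P.specialize c).ord = P.ord := by
    refine le_antisymm ?_ ?_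
    · have := hG.place.ord_red_le X
      rwa [hX, hXs] at this
    · by_contra! h
      rw [DiffOp.coeff_eq_zero_of_ord_lt h] at hlead
      exact zero_ne_one hlead
  have hmonic' : (P.specialize c).Monic := by
    rw [DiffOp.monic_iff, hord, hlead]
  have htG : (varT k m, varT k m) ∈ hG.place.graph := by
    have := hG.poly_mem (MvPolynomial.X none)
    rwa [substOn_X_none] at this
  obtain ⟨e⟩ := hG.place.nonempty_cyc_red_equiv derivT_varT htG exists_fraction_varT_constants
    (X := X) (L := L) (by rwa [hX]) (by rwa [hXs]) (by rw [hX, hXs, hord]) (by rwa [hX]) hL hf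
    (by rwa [hX])
  rw [hX, hXs] at e
  exact ⟨DiffOp.isSimilarTo_of_equiv hmonic hmonic' e,
    DiffOp.isSimilarTo_of_equiv hmonic' hmonic e.symm⟩

end
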